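/- **Setting.** Let $\mathsf B$ be a stationary Bratteli diagram: finite sets $V$ (vertices) and $E$ (edges), the same on every level, with surjective maps $\mathsf s,\mathsf r:E\to V$. Assume $\mathsf B$ is simple: for some $k\ge 1$ any two vertices are joined by a path of length $k$. Let $\Omega_n$ be the set of paths of length $n$ starting on the first level ($\Omega_0=V$), and $\Omega$ the space of infinite paths with the product topology. Let $S$ be a finite set of labels with an involution $F\mapsto F^{-1}$. *Tile inflation.* The tiles $\mathcal T_{v,n}$ ($v\in V$, $n\ge 0$) are $S$-labelled graphs; the vertices of $\mathcal T_{v,n}$ are the paths in $\Omega_n$ ending in $v$. On $\mathcal T_{v,0}$, a single vertex, there are no arrows and every label is *hanging*. For every $n$ a set of connectors $(\gamma,\gamma',F)$, $\gamma,\gamma'\in\Omega_{n+1}$, $F\in S$, is given such that: $\gamma,\gamma'$ end in the same vertex; $F$ hangs at the truncation of $\gamma$ to $\Omega_n$ and $F^{-1}$ at that of $\gamma'$; $(\gamma',\gamma,F^{-1})$ is again a connector; and $\gamma'$ is determined by $\gamma$ and $F$. The arrows of $\mathcal T_{v,n+1}$ are the arrows $\gamma e\to\gamma' e$ for all arrows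 $\gamma\to\gamma'$ of $\mathcal T_{\mathsf s(e),n}$ and all $e\in E$ with $\mathsf r(e)=v$, with the same label, together with an arrow $\gamma\to\gamma'$ labelled $F$ for every connector $(\gamma,\gamma',F)$. A label $F$ hangs at a vertex of $\mathcal T_{v,n+1}$ if it hangs at its truncation and no connector with label $F$ starts at this vertex. A vertex with a hanging label is a *boundary point*; $B_n\subset\Omega_n$ is the set of boundary points and $C_{n}\subset\Omega_{n}$ ($n\ge 1$) the set of endpoints of connectors of level $n$. Infinite tiles are the direct limits of the tiles along the truncations of infinite paths; an infinite path is a boundary point of an infinite tile if all its truncations are boundary points. *Bounded type.* All tiles are connected, $|B_n\cap\mathcal T_{v,n}|$ is bounded uniformly in $v,n$, only finitely many infinite paths are boundary points of infinite tiles, and there is $C$ such that for all $v,n$ every vertex of every infinite tile is at distance at most $C(\mathrm{Diam}(\mathcal T_{v,n})+1)$, in this infinite tile, from a copy of $\mathcal T_{v,n}$ embedded in it as a labelled graph. *Stationary.* For all sufficiently large $n$, the shift (removal of the first edge) restricts to bijections $B_{n+1}\to B_n$ and $C_{n+1}\to C_n$. *The group.* Every $F\in S$ acts as a homeomorphism of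 $\Omega$ with $F^{-1}$ acting as the inverse, and for every connector $(\gamma,\gamma',F)$ it sends $\gamma\tau$ to $\gamma'\tau$ for all continuations $\tau$. Let $G=\langle S\rangle$ be the group of homeomorphisms of $\Omega$ so generated. Assume that the action is minimal and that $G$ is contracting: there is a finite set $\mathcal N$ of partial transformations of $\Omega$ such that for every word $w=s_1\cdots s_m\in S^*$ there is $k$ with ${}_{(\omega,n)}|w\in\mathcal N$ for all $n\ge k$ and $\omega\in\Omega$. Here the section ${}_{(\omega,n)}|w$ is the partial transformation that sends $\tau$ to $\tau'$, where $\zeta\in\Omega$ is such that $\zeta s_1\cdots s_i$ and $\omega s_1\cdots s_i$ have the same first $n$ edges for all $0\le i\le m$, and $\tau,\tau'$ are obtained from $\zeta$, $\zeta s_1\cdots s_m$ by removing the first $n$ edges. *Traverses.* For $w\in S^*$, a traverse of $\mathcal T_{v,n}$ by $w$ is an occurrence in $w$ of a subword of length at least $2$ together with a starting vertex, such that the trajectory of the subword from this vertex runs along arrows of $\mathcal T_{v,n}$, begins and ends at two different boundary points of $\mathcal T_{v,n}$, and contains no other boundary point. Let $T_n$ be the number of traverses by $w$ of all tiles $\mathcal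 T_{v,n}$, $v\in V$, and $F_w(t)=\sum_{n\ge 0}T_nt^n$. **Proposition.** Suppose that there are $t_0>1$ and a function $\Psi$ such that for all $w\in S^*$ and all $0\le t<t_0$ the series $F_w(t)$ converges and $F_w(t)\le |w|\cdot\Psi(t)$. Put $\beta=\limsup_{n\to\infty}\bigl(\sum_{v}|\mathcal T_{v,n}|\bigr)^{1/n}$, and let $\gamma_G(R)$ be the number of elements of $G$ that are products of at most $R$ elements of $S$. Then for every $\alpha>\frac{\log\beta}{\log\beta+\log t_0}$ we have $\gamma_G(R)\preccurlyeq\exp(R^\alpha)$, that is, there is $C\ge 1$ with $\gamma_G(R)\le\exp((CR)^\alpha)$ for all real $R\ge 1$. -/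

import Mathlib

/-- A stationary Bratteli diagram: the vertex set `V`, the edge set `E` and the source and range
maps are the same on every level. -/
structure BratteliDiagram (V E : Type*) where
  src : E → V
  rng : E → V
  src_surjective : Function.Surjective src
  rng_surjective : Function.Surjective rng

namespace BratteliDiagram

/-- A path of length `n` starting on the first level: `n` composable edges together with the
`n + 1` vertices that they visit (for `n = 0` this is just a vertex). -/
@[ext]
structure FinPath {V E : Type*} (B : BratteliDiagram V E) (n : ℕ) where
  vert : Fin (n + 1) → V
  edge : Fin n → E
  src_edge : ∀ i, B.src (edge i) = vert i.castSucc
  rng_edge : ∀ i, B.rng (edge i) = vert i.succ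

namespace FinPath

/-- The vertex in which a finite path ends. -/
def last {V E : Type*} {B : BratteliDiagram V E} {n : ℕ} (p : B.FinPath n) : V :=
  p.vert (Fin.last n)

/-- Remove the last (deepest) edge. -/
def init {V E : Type*} {B : BratteliDiagram V E} {n : ℕ} (p : B.FinPath (n + 1)) :
    B.FinPath n where
  vert i := p.vert i.castSucc
  edge i := p.edge i.castSucc
  src_edge i := p.src_edge i.castSucc
  rng_edge i := p.rng_edge i.castSucc

/-- The last (deepest) edge. -/
def lastEdge {V E : Type*} {B : BratteliDiagram V E} {n : ℕ} (p : B.FinPath (n + 1)) : E :=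
  p.edge (Fin.last n)

/-- The shift `σ`: remove the first edge. -/
def shift {V E : Type*} {B : BratteliDiagram V E} {n : ℕ} (p : B.FinPath (n + 1)) :
    B.FinPath n where
  vert i := p.vert i.succ
  edge i := p.edge i.succ
  src_edge i := p.src_edge i.succ
  rng_edge i := p.rng_edge i.succ

end FinPath

/-- The diagram is simple: for some `k ≥ 1` any two vertices are joined by a path of length `k`. -/
def IsSimple {V E : Type*} (B : BratteliDiagram V E) : Prop :=
  ∃ k : ℕ, 0 < k ∧ ∀ u v : V, ∃ p : B.FinPath k, p.vert 0 = u ∧ p.last = v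

/-- The space `Ω(B)` of infinite paths. -/
def InfPath {V E : Type*} (B : BratteliDiagram V E) : Type _ :=
  {ω : ℕ → E // ∀ i, B.rng (ω i) = B.src (ω (i + 1))}

/-- The topology of `Ω(B)` as a subspace of the product of copies of the discrete set `E`. -/
instance {V E : Type*} (B : BratteliDiagram V E) : TopologicalSpace B.InfPath :=
  TopologicalSpace.induced (fun ω => ω.1) (@Pi.topologicalSpace ℕ (fun _ => E) (fun _ => ⊥))

namespace InfPath

/-- The `n`-th truncation of an infinite path. -/
def trunc {V E : Type*} {B : BratteliDiagram V E} (n : ℕ) (ω : B.InfPath) : B.FinPath n where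
  vert i := B.src (ω.1 i)
  edge i := ω.1 i
  src_edge _ := rfl
  rng_edge i := by simpa using ω.2 i

/-- The `n`-fold shift `σⁿ`: remove the first `n` edges. -/
def drop {V E : Type*} {B : BratteliDiagram V E} (n : ℕ) (ω : B.InfPath) : B.InfPath :=
  ⟨fun i => ω.1 (n + i), fun i => ω.2 (n + i)⟩

end InfPath

/-- `P n F γ γ'` says that `(γ, γ', F)` is a connector of level `n + 1`: in the construction of the
tiles of level `n + 1` an arrow labelled `F` is drawn from `γ` to `γ'`. -/
abbrev Connectors {V E : Type*} (B : BratteliDiagram V E) (S : Type*) : Type _ :=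
  ∀ n : ℕ, S → B.FinPath (n + 1) → B.FinPath (n + 1) → Prop

end BratteliDiagram

open BratteliDiagram

namespace BratteliDiagram.Connectors

/-- `P.IsOut n F γ`: on the level `n` tile an outgoing boundary ("hanging") edge labelled `F` is
attached to `γ` (equivalently, an incoming boundary edge labelled `F⁻¹`).  The tiles of level `0`
are single vertices at which all labels hang; a hanging edge of `γ` is inherited by every
one-edge continuation of `γ` unless a connector uses it there. -/
def IsOut {V E S : Type*} {B : BratteliDiagram V E} (P : B.Connectors S) :
    ∀ n : ℕ, S → B.FinPath n → Prop
  | 0, _, _ => True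
  | n + 1, F, γ => IsOut P n F γ.init ∧ ¬ ∃ γ', P n F γ γ'

/-- `P.TileEdge n F γ γ'`: in the tile of level `n` there is an arrow from `γ` to `γ'` labelled `F`.
A tile of level `n + 1` consists of copies of tiles of level `n` (all paths with a given last edge)
and of the arrows given by the connectors of level `n + 1`. -/
def TileEdge {V E S : Type*} {B : BratteliDiagram V E} (P : B.Connectors S) :
    ∀ n : ℕ, S → B.FinPath n → B.FinPath n → Prop
  | 0, _, _, _ => False
  | n + 1, F, γ, γ' =>
      P n F γ γ' ∨ (γ.lastEdge = γ'.lastEdge ∧ TileEdge P n F γ.init γ'.init)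

/-- The rules of a tile inflation process with a set of labels `S` carrying an involution. -/
structure IsTileInflation {V E S : Type*} [InvolutiveInv S] {B : BratteliDiagram V E}
    (P : B.Connectors S) : Prop where
  /-- Connectors join points of one tile. -/
  last_eq : ∀ {n F γ γ'}, P n F γ γ' → γ.last = γ'.last
  /-- Connectors join copies of tiles along compatible boundary edges. -/
  admissible : ∀ {n F γ γ'}, P n F γ γ' → P.IsOut n F γ.init ∧ P.IsOut n F⁻¹ γ'.init
  /-- Arrows come in mutually inverse pairs. -/
  symm : ∀ {n F γ γ'}, P n F γ γ' → P n F⁻¹ γ' γ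
  /-- The tiles are well-labelled. -/
  unique : ∀ {n F γ γ' γ''}, P n F γ γ' → P n F γ γ'' → γ' = γ''

/-- Boundary points of the tiles of level `n`. -/
def boundary {V E S : Type*} {B : BratteliDiagram V E} (P : B.Connectors S) (n : ℕ) :
    Set (B.FinPath n) :=
  {γ | ∃ F, P.IsOut n F γ}

/-- Connecting points of level `n + 1`. -/
def connecting {V E S : Type*} {B : BratteliDiagram V E} (P : B.Connectors S) (n : ℕ) :
    Set (B.FinPath (n + 1)) :=
  {γ | ∃ F γ', P n F γ γ' ∨ P n F γ' γ}

/-- Boundary points of infinite tiles. -/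
def infBoundary {V E S : Type*} {B : BratteliDiagram V E} (P : B.Connectors S) : Set B.InfPath :=
  {ω | ∀ n, ω.trunc n ∈ P.boundary n}

/-- Vertices of the tile `T_{v,n}`: the paths of length `n` ending in `v`. -/
abbrev Tile {V E : Type*} (B : BratteliDiagram V E) (n : ℕ) (v : V) : Type _ :=
  {γ : B.FinPath n // γ.last = v}

/-- The tile `T_{v,n}` as a graph, modulo loops, multiple edges and labels. -/
def tileGraph {V E S : Type*} {B : BratteliDiagram V E} (P : B.Connectors S) (n : ℕ) (v : V) :
    SimpleGraph (Tile B n v) :=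
  SimpleGraph.fromRel fun x y => ∃ F, P.TileEdge n F x.1 y.1

/-- Arrows of infinite tiles: the infinite tile of a path is the direct limit of the tiles of its
truncations. -/
def InfEdge {V E S : Type*} {B : BratteliDiagram V E} (P : B.Connectors S) (F : S)
    (x y : B.InfPath) : Prop :=
  ∃ n, P.TileEdge n F (x.trunc n) (y.trunc n) ∧ ∀ i, n ≤ i → x.1 i = y.1 i

/-- The disjoint union of all infinite tiles, modulo loops, multiple edges and labels. -/
def infGraph {V E S : Type*} {B : BratteliDiagram V E} (P : B.Connectors S) :
    SimpleGraph B.InfPath :=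
  SimpleGraph.fromRel fun x y => ∃ F, P.InfEdge F x y

/-- All finite tiles are linearly repetitive in all infinite tiles: from every vertex of an infinite
tile one reaches, within a distance linear in the diameter of `T_{v,n}`, an isomorphic copy of
`T_{v,n}` in this infinite tile. -/
def IsLinearlyRepetitive {V E S : Type*} {B : BratteliDiagram V E} (P : B.Connectors S) : Prop :=
  ∃ C : ℕ, ∀ (n : ℕ) (v : V) (ω : B.InfPath), ∃ f : Tile B n v → B.InfPath,
    Function.Injective f ∧
    (∀ F x y, P.TileEdge n F x.1 y.1 → P.InfEdge F (f x) (f y)) ∧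
    ∃ x, P.infGraph.edist ω (f x) ≤ ((C * ((P.tileGraph n v).diam + 1) : ℕ) : ℕ∞)

/-- A tile inflation process of bounded type (with connected tiles). -/
structure IsBoundedType {V E S : Type*} {B : BratteliDiagram V E} (P : B.Connectors S) : Prop where
  tile_connected : ∀ n v, (P.tileGraph n v).Preconnected
  boundary_bounded : ∃ N : ℕ, ∀ n v, {γ ∈ P.boundary n | γ.last = v}.encard ≤ N
  infBoundary_finite : P.infBoundary.Finite
  linearly_repetitive : P.IsLinearlyRepetitive

/-- The automaton of the tile inflation is stationary: from some level on, the shift restricts to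
bijections between the sets of boundary points, and between the sets of connecting points, of
consecutive levels. -/
def IsStationary {V E S : Type*} {B : BratteliDiagram V E} (P : B.Connectors S) : Prop :=
  ∃ N : ℕ, ∀ n, N ≤ n →
    Set.BijOn FinPath.shift (P.boundary (n + 1)) (P.boundary n) ∧
    Set.BijOn FinPath.shift (P.connecting (n + 1)) (P.connecting n)

/-- The traverses of `T_{v,n}` by the word `w`.  The triple `(k, l, γ)` stands for the occurrence of
a subword of length `l ≥ 2` that begins after the first `k` letters of `w` and whose trajectory from
`γ` runs inside the tile `T_{v,n}`, joins two different boundary points, and meets no boundary point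
in between. -/
def traverses {V E S : Type*} {B : BratteliDiagram V E} (P : B.Connectors S) (w : List S) (n : ℕ)
    (v : V) : Set (ℕ × ℕ × B.FinPath n) :=
  {q | 2 ≤ q.2.1 ∧ q.1 + q.2.1 ≤ w.length ∧ ∃ x : ℕ → B.FinPath n,
    x 0 = q.2.2 ∧ (x 0).last = v ∧
    (∀ i < q.2.1, ∃ s, w[q.1 + i]? = some s ∧ P.TileEdge n s (x i) (x (i + 1))) ∧
    x 0 ∈ P.boundary n ∧ x q.2.1 ∈ P.boundary n ∧ x 0 ≠ x q.2.1 ∧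
    ∀ i, 0 < i → i < q.2.1 → x i ∉ P.boundary n}

/-- The number `T_n` of traverses of the word `w` on all tiles of level `n`. -/
noncomputable def traverseCount {V E S : Type*} [Fintype V] {B : BratteliDiagram V E}
    (P : B.Connectors S) (w : List S) (n : ℕ) : ℕ :=
  ∑ v : V, (P.traverses w n v).ncard

/-- The exponential growth rate `β = limsup (∑ᵥ |T_{v,n}|)^{1/n}` of the sizes of the tiles. -/
noncomputable def tileGrowthRate {V E : Type*} [Fintype V] (B : BratteliDiagram V E) : ℝ :=
  Filter.limsup (fun n : ℕ => ((∑ v : V, Nat.card (Tile B n v) : ℕ) : ℝ) ^ (1 / (n : ℝ)))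
    Filter.atTop

/-- A perfectly labelled extension of the infinite tiles: every label acts as a homeomorphism of
`Ω(B)` that follows the arrows of the tiles (so only its values at boundary points of infinite tiles
are not prescribed by the tile inflation). -/
structure PerfectAction {V E S : Type*} [InvolutiveInv S] {B : BratteliDiagram V E}
    (P : B.Connectors S) where
  act : S → B.InfPath ≃ₜ B.InfPath
  act_inv : ∀ F, act F⁻¹ = (act F).symm
  act_connector : ∀ {n F γ γ'}, P n F γ γ' → ∀ ω : B.InfPath, ω.trunc (n + 1) = γ →
    (act F ω).trunc (n + 1) = γ' ∧ ∀ i, n + 1 ≤ i → (act F ω).1 i = ω.1 i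

namespace PerfectAction

/-- The homeomorphism given by a word (right action: the first letter acts first). -/
def word {V E S : Type*} [InvolutiveInv S] {B : BratteliDiagram V E} {P : B.Connectors S}
    (A : PerfectAction P) (w : List S) : B.InfPath ≃ₜ B.InfPath :=
  w.foldl (fun h s => h.trans (A.act s)) (Homeomorph.refl _)

/-- The group `G = ⟨S⟩` of homeomorphisms of `Ω(B)`. -/
def group {V E S : Type*} [InvolutiveInv S] {B : BratteliDiagram V E} {P : B.Connectors S}
    (A : PerfectAction P) : Subgroup (B.InfPath ≃ₜ B.InfPath) :=
  Subgroup.closure (Set.range A.act)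

/-- The growth function `γ_G(R)`: the number of elements of `G` of word length at most `R`. -/
noncomputable def growth {V E S : Type*} [InvolutiveInv S] {B : BratteliDiagram V E}
    {P : B.Connectors S} (A : PerfectAction P) (R : ℝ) : ℝ :=
  ({g : A.group | ∃ w : List S, (w.length : ℝ) ≤ R ∧ A.word w = g}.ncard : ℝ)

/-- The action on `Ω(B)` is minimal. -/
def IsMinimal {V E S : Type*} [InvolutiveInv S] {B : BratteliDiagram V E} {P : B.Connectors S}
    (A : PerfectAction P) : Prop :=
  ∀ ω : B.InfPath, Dense {ω' : B.InfPath | ∃ g ∈ A.group, g ω = ω'}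

/-- The section of the word `w` along `ω` at level `n`, as (the graph of) a partial transformation
of `Ω(B)`: the composition of the states that the letters of `w` reach after reading the first `n`
edges along the trajectory of `ω`.  The state of a letter `F` at `ω` sends `τ` to `τ'` if
`F` sends `ωₙτ` to `ω'ₙτ'`, where `ω' = ω · F`. -/
def sectionAlong {V E S : Type*} [InvolutiveInv S] {B : BratteliDiagram V E} {P : B.Connectors S}
    (A : PerfectAction P) (w : List S) (ω : B.InfPath) (n : ℕ) : Set (B.InfPath × B.InfPath) :=
  {p | ∃ ζ : B.InfPath,
    (∀ i ≤ w.length, (A.word (w.take i) ζ).trunc n = (A.word (w.take i) ω).trunc n) ∧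
    p = (ζ.drop n, (A.word w ζ).drop n)}

/-- `G` is contracting: there is a finite set (containing the nucleus) such that all sections of
any product of generators on all sufficiently deep levels belong to it. -/
def IsContracting {V E S : Type*} [InvolutiveInv S] {B : BratteliDiagram V E} {P : B.Connectors S}
    (A : PerfectAction P) : Prop :=
  ∃ N : Set (Set (B.InfPath × B.InfPath)), N.Finite ∧
    ∀ w : List S, ∃ k : ℕ, ∀ n, k ≤ n → ∀ ω : B.InfPath, A.sectionAlong w ω n ∈ N

end PerfectAction

end BratteliDiagram.Connectors

/-- Domination `f₁ ≼ f₂` of growth functions. -/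
def GrowthDominated (f₁ f₂ : ℝ → ℝ) : Prop :=
  ∃ C : ℝ, 1 ≤ C ∧ ∀ R : ℝ, 1 ≤ R → f₁ R ≤ f₂ (C * R)

/-!
Follow the trajectory of an infinite path under a word `w` on the tiles of level `n`. Along an
arrow of a tile only the first `n` edges of the path change. Everything else happens near the
boundary, where stationarity and contraction leave only finitely many germs, given by a finite set
`U` of words that does not depend on `n`. As long as no tile is traversed, every excursion into
the interior returns to the boundary point from which it started, so the whole piece of `w` acts
by replacing the first `n` edges, applying a single word from `U`, and replacing the first `n`
edges again; which replacements and which word is determined by `n + m` edges, with `m`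
independent of `n`.

Cutting `w` at the ends of the traverses therefore turns it into a transducer that remembers only
the end of the last traverse and reads `m` edges in each step. An element of `G` is determined by
such a transducer, so `log γ_G(R)` is, up to logarithmic factors, at most `|Ω_n| + T_n`. Since
`|Ω_n| ≤ exp (l * n)` for each `l > log β`, and the bound on the generating function at `exp τ`
with `τ < log t₀` gives `T_n = O(R / exp (τ * n))`, the choice `n ≈ log R / (l + τ)` bounds both
terms by a multiple of `R ^ (l / (l + τ))`.
-/

namespace BratteliDiagram

open Filter Topology

variable {V E : Type*} {B : BratteliDiagram V E}

instance [Finite V] [Finite E] (n : ℕ) : Finite (B.FinPath n) :=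
  Finite.of_injective (fun p : B.FinPath n => (p.vert, p.edge)) fun p q h => by
    simp only [Prod.mk.injEq] at h
    exact FinPath.ext h.1 h.2

theorem FinPath.ext_init_lastEdge {n : ℕ} {p q : B.FinPath (n + 1)} (hi : p.init = q.init)
    (he : p.lastEdge = q.lastEdge) : p = q := by
  have hvert : ∀ i : Fin (n + 1), p.vert i.castSucc = q.vert i.castSucc :=
    congrFun (congrArg FinPath.vert hi)
  have hedge : ∀ i : Fin n, p.edge i.castSucc = q.edge i.castSucc :=
    congrFun (congrArg FinPath.edge hi)
  have hlast : p.edge (Fin.last n) = q.edge (Fin.last n) := he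
  refine FinPath.ext (funext fun i => ?_) (funext fun i => Fin.lastCases hlast hedge i)
  refine Fin.lastCases ?_ hvert i
  rw [← Fin.succ_last, ← p.rng_edge, ← q.rng_edge, hlast]

theorem FinPath.ext_init_shift {n : ℕ} {p q : B.FinPath (n + 2)} (hi : p.init = q.init)
    (hs : p.shift = q.shift) : p = q :=
  FinPath.ext_init_lastEdge hi (congrFun (congrArg FinPath.edge hs) (Fin.last n))

namespace InfPath

theorem trunc_eq_iff {n : ℕ} {ω ζ : B.InfPath} :
    ω.trunc n = ζ.trunc n ↔ (∀ i < n, ω.1 i = ζ.1 i) ∧ B.src (ω.1 n) = B.src (ζ.1 n) := by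
  constructor
  · intro h
    exact ⟨fun i hi => congrFun (congrArg FinPath.edge h) ⟨i, hi⟩,
      congrFun (congrArg FinPath.vert h) (Fin.last n)⟩
  · rintro ⟨hedge, hsrc⟩
    refine FinPath.ext (funext fun i => ?_) (funext fun i => hedge i i.2)
    exact Fin.lastCases hsrc (fun i => congrArg B.src (hedge i i.2)) i

theorem trunc_succ_eq_iff {n : ℕ} {ω ζ : B.InfPath} :
    ω.trunc (n + 1) = ζ.trunc (n + 1) ↔ ∀ i ≤ n, ω.1 i = ζ.1 i := by
  rw [trunc_eq_iff]
  refine ⟨fun h i hi => h.1 i (Nat.lt_succ_of_le hi), fun h => ⟨fun i hi => h i (by omega), ?_⟩⟩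
  rw [← ω.2, ← ζ.2, h n le_rfl]

theorem trunc_eq_of_le {m n : ℕ} (hmn : m ≤ n) {ω ζ : B.InfPath} (h : ω.trunc n = ζ.trunc n) :
    ω.trunc m = ζ.trunc m := by
  induction n, hmn using Nat.le_induction with
  | base => exact h
  | succ n _ ih => exact ih (congrArg FinPath.init h)

theorem drop_eq_iff {n : ℕ} {ω ζ : B.InfPath} :
    ω.drop n = ζ.drop n ↔ ∀ i, n ≤ i → ω.1 i = ζ.1 i := by
  constructor
  · intro h i hi
    obtain ⟨j, rfl⟩ := Nat.exists_eq_add_of_le hi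
    exact congrFun (congrArg Subtype.val h) j
  · exact fun h => Subtype.ext (funext fun i => h _ (Nat.le_add_right _ _))

theorem drop_zero (ω : B.InfPath) : ω.drop 0 = ω :=
  Subtype.ext (funext fun i => congrArg ω.1 (Nat.zero_add i))

theorem drop_drop (m n : ℕ) (ω : B.InfPath) : (ω.drop m).drop n = ω.drop (m + n) :=
  Subtype.ext (funext fun i => congrArg ω.1 (Nat.add_assoc m n i).symm)

theorem ext_trunc_drop {n : ℕ} {ω ζ : B.InfPath} (ht : ω.trunc n = ζ.trunc n)
    (hd : ω.drop n = ζ.drop n) : ω = ζ :=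
  Subtype.ext (funext fun i => (lt_or_ge i n).elim ((trunc_eq_iff.1 ht).1 i) (drop_eq_iff.1 hd i))

theorem trunc_add_eq_iff {n m : ℕ} {ω ζ : B.InfPath} :
    ω.trunc (n + m) = ζ.trunc (n + m) ↔
      ω.trunc n = ζ.trunc n ∧ (ω.drop n).trunc m = (ζ.drop n).trunc m := by
  constructor
  · intro h
    refine ⟨trunc_eq_of_le (Nat.le_add_right n m) h, ?_⟩
    rw [trunc_eq_iff] at h ⊢
    exact ⟨fun i hi => h.1 _ (by omega), h.2⟩
  · rintro ⟨hn, hm⟩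
    rw [trunc_eq_iff] at hn hm ⊢
    refine ⟨fun i hi => (lt_or_ge i n).elim (hn.1 i) fun hni => ?_, hm.2⟩
    obtain ⟨k, rfl⟩ := Nat.exists_eq_add_of_le hni
    exact hm.1 k (by omega)

theorem trunc_shift {n : ℕ} (ω : B.InfPath) : (ω.trunc (n + 1)).shift = (ω.drop 1).trunc n := by
  refine FinPath.ext (funext fun i => ?_) (funext fun i => ?_) <;>
    simp [trunc, drop, FinPath.shift, add_comm]

theorem eq_of_forall_trunc {ω ζ : B.InfPath} (h : ∀ n, ω.trunc n = ζ.trunc n) : ω = ζ :=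
  Subtype.ext (funext fun i => trunc_succ_eq_iff.1 (h (i + 1)) i le_rfl)

section Splice

/-- The infinite path obtained by continuing the finite path `γ` by `τ`. -/
def splice {n : ℕ} (γ : B.FinPath n) (τ : B.InfPath) (h : B.src (τ.1 0) = γ.last) : B.InfPath :=
  ⟨fun i => if hi : i < n then γ.edge ⟨i, hi⟩ else τ.1 (i - n), fun i => by
    rcases lt_trichotomy (i + 1) n with hi | rfl | hi
    · simp only [hi, (Nat.lt_succ_self i).trans hi, dite_true]
      exact (γ.rng_edge ⟨i, _⟩).trans (γ.src_edge ⟨i + 1, hi⟩).symm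
    · simp only [Nat.lt_succ_self, lt_irrefl, dite_true, dite_false, Nat.sub_self, h]
      exact γ.rng_edge (Fin.last i)
    · simp only [show ¬ i < n by omega, show ¬ i + 1 < n by omega, dite_false]
      rw [τ.2, Nat.sub_add_comm (by omega)]⟩

theorem drop_splice {n : ℕ} (γ : B.FinPath n) (τ : B.InfPath) (h : B.src (τ.1 0) = γ.last) :
    (splice γ τ h).drop n = τ :=
  Subtype.ext (funext fun i => by simp [splice, drop])

theorem trunc_splice {n : ℕ} (γ : B.FinPath n) (τ : B.InfPath) (h : B.src (τ.1 0) = γ.last) :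
    (splice γ τ h).trunc n = γ := by
  have hedge : ∀ i : Fin n, (splice γ τ h).1 i = γ.edge i := fun i => dif_pos i.2
  refine FinPath.ext (funext fun i => Fin.lastCases ?_ (fun i => ?_) i) (funext hedge)
  · refine Eq.trans ?_ h
    simp [splice, trunc]
  · exact (congrArg B.src (hedge i)).trans (γ.src_edge i)

open Classical in
/-- Replace the first `n` edges of `ω` by `γ`. If this does not give a path, the value is `ω`. -/
noncomputable def replace {n : ℕ} (γ : B.FinPath n) (ω : B.InfPath) : B.InfPath :=
  if h : (ω.trunc n).last = γ.last then splice γ (ω.drop n) h else ω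

theorem drop_replace {n : ℕ} (γ : B.FinPath n) (ω : B.InfPath) :
    (replace γ ω).drop n = ω.drop n := by
  rw [replace]
  split_ifs
  exacts [drop_splice _ _ _, rfl]

theorem trunc_replace {n : ℕ} {γ : B.FinPath n} {ω : B.InfPath} (h : γ.last = (ω.trunc n).last) :
    (replace γ ω).trunc n = γ := by
  rw [replace, dif_pos h.symm]
  exact trunc_splice _ _ _

theorem replace_eq {n : ℕ} {γ : B.FinPath n} {ω ζ : B.InfPath} (ht : ζ.trunc n = γ)
    (hd : ζ.drop n = ω.drop n) : replace γ ω = ζ := by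
  refine ext_trunc_drop (n := n) ?_ ((drop_replace γ ω).trans hd.symm)
  rw [trunc_replace, ht]
  rw [← ht]
  exact congrArg (fun τ : B.InfPath => B.src (τ.1 0)) hd

end Splice

theorem exists_src_eq (v : V) : ∃ ω : B.InfPath, B.src (ω.1 0) = v := by
  choose g hg using B.src_surjective
  let f : ℕ → E := fun n => Nat.rec (g v) (fun _ e => g (B.rng e)) n
  exact ⟨⟨f, fun i => (hg _).symm⟩, hg v⟩

instance [Nonempty V] : Nonempty B.InfPath :=
  (exists_src_eq (Classical.arbitrary V)).nonempty

instance [Nonempty V] (n : ℕ) : Nonempty (B.FinPath n) :=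
  ⟨trunc n (Classical.arbitrary _)⟩

/-- The witness repeats the first `p` edges of `ω`. -/
theorem exists_periodic {n p : ℕ} (hp : 0 < p) {ω : B.InfPath}
    (h : ω.trunc (n + 1) = (ω.drop p).trunc (n + 1)) :
    ∃ ξ : B.InfPath, ∀ r, (ξ.drop r).trunc (n + 1) = (ω.drop (r % p)).trunc (n + 1) := by
  have hω : ∀ i < p + (n + 1), ω.1 i = ω.1 (i % p) := by
    intro i
    induction i using Nat.strong_induction_on with
    | _ i ih =>
      intro hi
      rcases lt_or_ge i p with hip | hip
      · rw [Nat.mod_eq_of_lt hip]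
      · obtain ⟨k, rfl⟩ := Nat.exists_eq_add_of_le hip
        rw [Nat.add_mod_left, ← ih k (by omega) (by omega)]
        exact (trunc_succ_eq_iff.1 h k (by omega)).symm
  have hcompat : ∀ i, B.rng (ω.1 (i % p)) = B.src (ω.1 ((i + 1) % p)) := fun i => by
    have hlt := Nat.mod_lt i hp
    rw [ω.2, ← Nat.mod_add_mod, ← hω _ (by omega)]
  refine ⟨⟨fun i => ω.1 (i % p), hcompat⟩, fun r => trunc_succ_eq_iff.2 fun i hi => ?_⟩
  have hlt := Nat.mod_lt r hp
  change ω.1 ((r + i) % p) = ω.1 (r % p + i)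
  rw [← Nat.mod_add_mod, ← hω _ (by omega)]

theorem hasAntitoneBasis_nhds (ω : B.InfPath) :
    (𝓝 ω).HasAntitoneBasis fun n => {ζ : B.InfPath | ζ.trunc n = ω.trunc n} := by
  let _ : TopologicalSpace E := ⊥
  have : DiscreteTopology E := ⟨rfl⟩
  refine ⟨hasBasis_iff.2 fun s => ?_, fun m n hmn ζ hζ => trunc_eq_of_le hmn hζ⟩
  rw [show 𝓝 ω = comap (fun ζ : B.InfPath => ζ.1) (𝓝 ω.1) from nhds_induced _ _, mem_comap]
  simp only [nhds_pi, nhds_discrete, true_and]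
  constructor
  · rintro ⟨t, ht, hts⟩
    obtain ⟨I, u, hu, hut⟩ := mem_pi'.1 ht
    refine ⟨I.sup id + 1, fun ζ hζ => hts (hut fun i hi => ?_)⟩
    have hζi : ζ.1 i = ω.1 i := trunc_succ_eq_iff.1 hζ i (Finset.le_sup (f := id) hi)
    exact Set.mem_of_eq_of_mem hζi (mem_pure.1 (hu i))
  · rintro ⟨n, hn⟩
    refine ⟨(Set.Iic n).pi fun i => {ω.1 i}, pi_mem_pi (Set.finite_Iic n) fun i _ => rfl, ?_⟩
    intro ζ hζ
    exact hn (trunc_eq_of_le n.le_succ (trunc_succ_eq_iff.2 fun i hi => hζ i hi))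

theorem eventually_trunc_eq (n : ℕ) (ω : B.InfPath) : ∀ᶠ ζ in 𝓝 ω, ζ.trunc n = ω.trunc n :=
  (hasAntitoneBasis_nhds ω).mem n

theorem eventually_trunc_ne {ω ζ : B.InfPath} (h : ω ≠ ζ) :
    ∀ᶠ n in atTop, ω.trunc n ≠ ζ.trunc n := by
  obtain ⟨k, hk⟩ : ∃ k, ω.trunc k ≠ ζ.trunc k := by
    by_contra! hall
    exact h (eq_of_forall_trunc hall)
  exact eventually_atTop.2 ⟨k, fun n hn h => hk (trunc_eq_of_le hn h)⟩

theorem eventually_forall_trunc_ne {f : B.InfPath → B.InfPath} {ξ : B.InfPath}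
    (hf : ContinuousAt f ξ) {X : Set B.InfPath} (hX : X.Finite) (hξ : f ξ ∉ X) :
    ∀ᶠ n in atTop, ∀ ζ : B.InfPath, ζ.trunc n = ξ.trunc n →
      ∀ ξ' ∈ X, (f ζ).trunc n ≠ ξ'.trunc n := by
  have hsep : ∀ᶠ k in atTop, ∀ ξ' ∈ X, (f ξ).trunc k ≠ ξ'.trunc k :=
    (eventually_all_finite hX).2 fun ξ' hξ' => eventually_trunc_ne fun h => hξ (h ▸ hξ')
  obtain ⟨k, hk⟩ := hsep.exists
  filter_upwards [eventually_ge_atTop k, (hasAntitoneBasis_nhds ξ).eventually_subset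
    (hf.eventually (eventually_trunc_eq k (f ξ)))] with n hkn hn ζ hζ ξ' hξ' heq
  exact hk ξ' hξ' ((hn hζ).symm.trans (trunc_eq_of_le hkn heq))

theorem eventually_injOn_trunc {X : Set B.InfPath} (hX : X.Finite) :
    ∀ᶠ n in atTop, Set.InjOn (trunc n) X := by
  have hpair : ∀ᶠ n in atTop, ∀ p ∈ X ×ˢ X, p.1.trunc n = p.2.trunc n → p.1 = p.2 := by
    refine (eventually_all_finite (hX.prod hX)).2 fun p _ => ?_
    by_cases hp : p.1 = p.2
    · exact Eventually.of_forall fun _ _ => hp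
    · exact (eventually_trunc_ne hp).mono fun _ hne heq => (hne heq).elim
  exact hpair.mono fun n hn ω hω ζ hζ => hn (ω, ζ) ⟨hω, hζ⟩

end InfPath

end BratteliDiagram

/-- A finite state machine: in a given state, on reading a letter of `L`, it performs a move from
`M` and either passes to a new state or halts. -/
abbrev Transducer (Q L M : Type*) : Type _ := Q → L → M × Option Q

namespace Transducer

variable {Q L M X : Type*} {read : X → L} {move : M → X → X}

/-- Started in the given state, the transducer `t` transforms `x` into `y` and halts. Here `read x`
is the letter that the transducer sees at `x`, and `move c x` is the result of the move `c`. -/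
inductive Computes (read : X → L) (move : M → X → X) (t : Transducer Q L M) : Q → X → X → Prop
  | halt {a : Q} {x : X} (h : (t a (read x)).2 = none) :
      Computes read move t a x (move (t a (read x)).1 x)
  | step {a a' : Q} {x y : X} (h : (t a (read x)).2 = some a')
      (hy : Computes read move t a' (move (t a (read x)).1 x) y) : Computes read move t a x y

theorem Computes.unique {t : Transducer Q L M} {a : Q} {x y y' : X}
    (h : Computes read move t a x y) (h' : Computes read move t a x y') : y = y' := by
  induction h with
  | halt h => cases h' with
    | halt => rfl
    | step h₁ => exact absurd (h.symm.trans h₁) nofun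
  | step h _ ih => cases h' with
    | halt h₁ => exact absurd (h₁.symm.trans h) nofun
    | step h₁ hy => exact ih (Option.some.inj (h₁.symm.trans h) ▸ hy)

/-- In the state `a`, the instruction makes correct progress at `x` towards computing `f a x`:
the invariant `I` is preserved and `rank` decreases. -/
def IsCorrectAt (move : M → X → X) (f : Q → X → X) (I : Q → X → Prop) (rank : Q → ℕ) (a : Q) (x : X)
    (instruction : M × Option Q) : Prop :=
  (instruction.2 = none → move instruction.1 x = f a x) ∧
  ∀ a', instruction.2 = some a' → I a' (move instruction.1 x) ∧ rank a' < rank a ∧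
    f a' (move instruction.1 x) = f a x

theorem exists_computes [Nonempty M] {f : Q → X → X} {I : Q → X → Prop} {rank : Q → ℕ}
    (h : ∀ a x, I a x → ∃ instruction, ∀ y, I a y → read y = read x →
      IsCorrectAt move f I rank a y instruction) :
    ∃ t : Transducer Q L M, ∀ a x, I a x → Computes read move t a x (f a x) := by
  have hentry : ∀ a l, ∃ instruction, ∀ y, I a y → read y = l →
      IsCorrectAt move f I rank a y instruction := fun a l => by
    by_cases hx : ∃ x, I a x ∧ read x = l
    · obtain ⟨x, hI, rfl⟩ := hx
      exact h a x hI
    · exact ⟨Classical.arbitrary _, fun y hI hy => absurd ⟨y, hI, hy⟩ hx⟩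
  choose t ht using hentry
  refine ⟨t, fun a => ?_⟩
  induction hr : rank a using Nat.strong_induction_on generalizing a with
  | _ r ih =>
    intro x hI
    obtain ⟨hhalt, hstep⟩ := ht a (read x) x hI rfl
    cases hnext : (t a (read x)).2 with
    | none => exact hhalt hnext ▸ Computes.halt hnext
    | some a' =>
      obtain ⟨hI', hrank, hf⟩ := hstep a' hnext
      exact Computes.step hnext (hf ▸ ih (rank a') (hr ▸ hrank) a' rfl _ hI')

theorem ncard_le_of_computes [Finite Q] [Finite L] [Finite M] {G : Type*} {s : Set G}
    {φ : G → X → X} (hφ : Function.Injective φ) (start : X → Q)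
    (h : ∀ g ∈ s, ∃ t : Transducer Q L M, ∀ x, Computes read move t (start x) x (φ g x)) :
    s.ncard ≤ (Nat.card M * (Nat.card Q + 1)) ^ (Nat.card L * Nat.card Q) := by
  choose t ht using fun g : s => h g g.2
  have hinj : Function.Injective t := fun g g' heq =>
    Subtype.ext (hφ (funext fun x => (ht g x).unique (heq ▸ ht g' x)))
  rw [← Nat.card_coe_set_eq]
  refine (Nat.card_le_card_of_injective t hinj).trans_eq ?_
  rw [Nat.card_fun, Nat.card_fun, Nat.card_prod, Finite.card_option, pow_mul]

end Transducer

namespace BratteliDiagram.Connectors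

open Filter Topology InfPath

variable {V E S : Type*} {B : BratteliDiagram V E} {P : B.Connectors S}

theorem trunc_mem_boundary_of_le {m n : ℕ} (hmn : m ≤ n) {ω : B.InfPath}
    (h : ω.trunc n ∈ P.boundary n) : ω.trunc m ∈ P.boundary m := by
  induction n, hmn using Nat.le_induction with
  | base => exact h
  | succ n _ ih => exact ih (h.imp fun F hF => hF.1)

/-- The half of stationarity that concerns boundary points, with an explicit level `N` from which
on it holds. -/
def BoundaryStationaryFrom (P : B.Connectors S) (N : ℕ) : Prop :=
  ∀ n, N ≤ n → Set.BijOn FinPath.shift (P.boundary (n + 1)) (P.boundary n)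

namespace BoundaryStationaryFrom

variable {N n : ℕ}

theorem drop_one_trunc_mem (h : P.BoundaryStationaryFrom N) (hn : N ≤ n) {ω : B.InfPath}
    (hω : ω.trunc (n + 1) ∈ P.boundary (n + 1)) : (ω.drop 1).trunc n ∈ P.boundary n := by
  rw [← trunc_shift]
  exact (h n hn).mapsTo hω

theorem drop_trunc_mem (h : P.BoundaryStationaryFrom N) (hn : N ≤ n) {i : ℕ} {ω : B.InfPath}
    (hω : ω.trunc (n + i) ∈ P.boundary (n + i)) : (ω.drop i).trunc n ∈ P.boundary n := by
  induction i generalizing ω with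
  | zero => rwa [drop_zero]
  | succ i ih =>
    rw [add_comm i, ← drop_drop]
    exact ih (h.drop_one_trunc_mem (by omega) hω)

theorem trunc_add_eq (h : P.BoundaryStationaryFrom N) (hn : N ≤ n) {i : ℕ} {ω ζ : B.InfPath}
    (hω : ω.trunc (n + i) ∈ P.boundary (n + i)) (hζ : ζ.trunc (n + i) ∈ P.boundary (n + i))
    (heq : (ω.drop i).trunc n = (ζ.drop i).trunc n) : ω.trunc (n + i) = ζ.trunc (n + i) := by
  induction i generalizing ω ζ with
  | zero => rwa [drop_zero, drop_zero] at heq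
  | succ i ih =>
    have hn' : N ≤ n + i := hn.trans (Nat.le_add_right n i)
    rw [add_comm i, ← drop_drop, ← drop_drop] at heq
    refine (h (n + i) hn').injOn hω hζ ((trunc_shift ω).trans (Eq.trans ?_ (trunc_shift ζ).symm))
    exact ih (h.drop_one_trunc_mem hn' hω) (h.drop_one_trunc_mem hn' hζ) heq

theorem trunc_add_two_mem (h : P.BoundaryStationaryFrom N) (hn : N ≤ n) {ω : B.InfPath}
    (hω : ω.trunc (n + 1) ∈ P.boundary (n + 1))
    (hd : (ω.drop 1).trunc (n + 1) ∈ P.boundary (n + 1)) :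
    ω.trunc (n + 2) ∈ P.boundary (n + 2) := by
  obtain ⟨γ, hγ, hshift⟩ := (h (n + 1) (hn.trans n.le_succ)).surjOn hd
  have hinit : γ.init = ω.trunc (n + 1) :=
    (h n hn).injOn (hγ.imp fun F hF => hF.1) hω
      ((congrArg FinPath.init hshift).trans (trunc_shift ω).symm)
  have hγω : γ = ω.trunc (n + 2) :=
    FinPath.ext_init_shift hinit (hshift.trans (trunc_shift ω).symm)
  exact hγω ▸ hγ

theorem mem_infBoundary_of_forall_drop (h : P.BoundaryStationaryFrom N) (hn : N ≤ n)
    {ξ : B.InfPath} (hξ : ∀ r, (ξ.drop r).trunc (n + 1) ∈ P.boundary (n + 1)) :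
    ξ ∈ P.infBoundary := by
  have hwindows : ∀ k r, (ξ.drop r).trunc (n + k + 1) ∈ P.boundary (n + k + 1) := by
    intro k
    induction k with
    | zero => exact hξ
    | succ k ih =>
      refine fun r => h.trunc_add_two_mem (hn.trans (Nat.le_add_right n k)) (ih r) ?_
      rw [drop_drop]
      exact ih (r + 1)
  intro k
  have hk := hwindows k 0
  rw [drop_zero] at hk
  exact trunc_mem_boundary_of_le (by omega) hk

theorem ncard_boundary (h : P.BoundaryStationaryFrom N) (hn : N ≤ n) :
    (P.boundary n).ncard = (P.boundary N).ncard := by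
  induction n, hn using Nat.le_induction with
  | base => rfl
  | succ n hn ih => rw [← ih, ← (h n hn).image_eq, (h n hn).injOn.ncard_image]

theorem finite_infBoundary [Finite V] [Finite E] (h : P.BoundaryStationaryFrom N) :
    P.infBoundary.Finite := by
  by_contra hinf
  obtain ⟨X, hX, hcard⟩ := Set.Infinite.exists_subset_card_eq hinf ((P.boundary N).ncard + 1)
  obtain ⟨n, hinj, hn⟩ :=
    ((eventually_injOn_trunc X.finite_toSet).and (eventually_ge_atTop N)).exists
  have hle : (X : Set B.InfPath).ncard ≤ (P.boundary n).ncard :=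
    Set.ncard_le_ncard_of_injOn (trunc n) (fun ω hω => hX hω n) hinj (Set.toFinite _)
  rw [Set.ncard_coe_finset, hcard, h.ncard_boundary hn] at hle
  exact Nat.not_succ_le_self _ hle

/-- Among the windows of a long boundary path two agree, and the coincidence moves to the beginning
of the path since the shift is injective on boundary points. Repeating this period yields a boundary
point of an infinite tile. -/
theorem exists_mem_infBoundary [Finite V] [Finite E] (h : P.BoundaryStationaryFrom N) :
    ∃ j, ∀ᶠ n in atTop, ∀ ω : B.InfPath, ω.trunc (n + j) ∈ P.boundary (n + j) →
      ∃ ξ ∈ P.infBoundary, ω.trunc n = ξ.trunc n := by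
  refine ⟨(P.boundary N).ncard, eventually_atTop.2 ⟨N + 1, fun k hk ω hω => ?_⟩⟩
  obtain ⟨n, rfl, hn⟩ : ∃ n, k = n + 1 ∧ N ≤ n := ⟨k - 1, by omega, by omega⟩
  set j := (P.boundary N).ncard
  have hwindow : ∀ i l, i + l ≤ j → (ω.drop i).trunc (n + 1 + l) ∈ P.boundary (n + 1 + l) :=
    fun i l hil => h.drop_trunc_mem (by omega) (trunc_mem_boundary_of_le (by omega) hω)
  obtain ⟨x, y, hy, hxy, heq⟩ : ∃ x y, y ≤ j ∧ x < y ∧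
      (ω.drop x).trunc (n + 1) = (ω.drop y).trunc (n + 1) := by
    have hcard : (P.boundary (n + 1)).ncard < (Set.Iic j).ncard := by
      rw [h.ncard_boundary (by omega), Set.ncard_Iic_nat]
      exact Nat.lt_succ_self j
    obtain ⟨x, hx, y, hy, hne, heq⟩ := Set.exists_ne_map_eq_of_ncard_lt_of_maps_to hcard
      (f := fun i => (ω.drop i).trunc (n + 1)) (fun i hi => hwindow i 0 hi) (Set.toFinite _)
    rcases hne.lt_or_gt with hlt | hlt
    exacts [⟨x, y, hy, hlt, heq⟩, ⟨y, x, hx, hlt, heq.symm⟩]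
  have hperiod : ω.trunc (n + 1) = (ω.drop (y - x)).trunc (n + 1) := by
    refine trunc_eq_of_le (Nat.le_add_right _ x) (h.trunc_add_eq (by omega) ?_ ?_ ?_)
    · simpa only [drop_zero] using hwindow 0 x (by omega)
    · exact hwindow (y - x) x (by omega)
    · rwa [drop_drop, Nat.sub_add_cancel hxy.le]
  obtain ⟨ξ, hξ⟩ := exists_periodic (by omega) hperiod
  refine ⟨ξ, h.mem_infBoundary_of_forall_drop hn fun r => ?_, ?_⟩
  · rw [hξ]
    have hlt := Nat.mod_lt r (show 0 < y - x by omega)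
    exact hwindow (r % (y - x)) 0 (by omega)
  · simpa only [drop_zero, Nat.zero_mod] using (hξ 0).symm

end BoundaryStationaryFrom

section Action

variable [InvolutiveInv S]

theorem IsTileInflation.tileEdge_symm (hP : P.IsTileInflation) :
    ∀ {n : ℕ} {F : S} {γ γ' : B.FinPath n}, P.TileEdge n F γ γ' → P.TileEdge n F⁻¹ γ' γ
  | 0, _, _, _, h => h
  | _ + 1, _, _, _, h => h.imp hP.symm fun h => ⟨h.1.symm, hP.tileEdge_symm h.2⟩

namespace PerfectAction

variable (A : PerfectAction P)

@[simp]
theorem word_nil (ω : B.InfPath) : A.word [] ω = ω := rfl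

theorem word_concat (w : List S) (s : S) (ω : B.InfPath) :
    A.word (w ++ [s]) ω = A.act s (A.word w ω) := by
  simp [word, List.foldl_append]

theorem word_append (w₁ w₂ : List S) (ω : B.InfPath) :
    A.word (w₁ ++ w₂) ω = A.word w₂ (A.word w₁ ω) := by
  induction w₂ using List.reverseRecOn with
  | nil => simp
  | append_singleton w s ih => rw [← List.append_assoc, word_concat, ih, word_concat]

theorem word_take_succ (w : List S) {k : ℕ} {s : S} (h : w[k]? = some s) (ω : B.InfPath) :
    A.word (w.take (k + 1)) ω = A.act s (A.word (w.take k) ω) := by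
  rw [List.take_add_one, h]
  exact A.word_concat _ _ _

theorem act_tileEdge : ∀ {n : ℕ} {F : S} {ω : B.InfPath} {γ : B.FinPath n},
    P.TileEdge n F (ω.trunc n) γ → (A.act F ω).trunc n = γ ∧ (A.act F ω).drop n = ω.drop n
  | 0, _, _, _, h => h.elim
  | n + 1, F, ω, γ, h => by
    rcases h with h | ⟨hlast, h⟩
    · obtain ⟨htrunc, htail⟩ := A.act_connector h ω rfl
      exact ⟨htrunc, drop_eq_iff.2 htail⟩
    · obtain ⟨htrunc, hdrop⟩ := act_tileEdge (n := n) (ω := ω) h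
      have htail := drop_eq_iff.1 hdrop
      exact ⟨FinPath.ext_init_lastEdge htrunc ((htail n le_rfl).trans hlast),
        drop_eq_iff.2 fun i hi => htail i (by omega)⟩

theorem isOut_or_tileEdge (F : S) (ω : B.InfPath) : ∀ n : ℕ,
    P.IsOut n F (ω.trunc n) ∨ P.TileEdge n F (ω.trunc n) ((A.act F ω).trunc n)
  | 0 => Or.inl trivial
  | n + 1 => by
    rcases isOut_or_tileEdge F ω n with h | h
    · by_cases hc : ∃ γ', P n F (ω.trunc (n + 1)) γ'
      · obtain ⟨γ', hγ⟩ := hc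
        rw [(A.act_connector hγ ω rfl).1]
        exact Or.inr (Or.inl hγ)
      · exact Or.inl ⟨h, hc⟩
    · exact Or.inr (Or.inr ⟨(drop_eq_iff.1 (A.act_tileEdge h).2 n le_rfl).symm, h⟩)

theorem tileEdge_or_mem_boundary (hP : P.IsTileInflation) (n : ℕ) (F : S) (ω : B.InfPath) :
    P.TileEdge n F (ω.trunc n) ((A.act F ω).trunc n) ∨
      ω.trunc n ∈ P.boundary n ∧ (A.act F ω).trunc n ∈ P.boundary n := by
  rcases A.isOut_or_tileEdge F ω n with h | h
  · rcases A.isOut_or_tileEdge F⁻¹ (A.act F ω) n with h' | h'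
    · exact Or.inr ⟨⟨F, h⟩, ⟨F⁻¹, h'⟩⟩
    · have hsymm := hP.tileEdge_symm h'
      rw [A.act_inv, Homeomorph.symm_apply_apply, inv_inv] at hsymm
      exact Or.inl hsymm
  · exact Or.inl h

section Continuity

variable {N : ℕ}

/-- A letter fails to act along an arrow only near the finitely many boundary points of infinite
tiles, where continuity can be used. -/
theorem exists_act_modulus [Finite V] [Finite E] [Finite S] (hP : P.IsTileInflation)
    (hst : P.BoundaryStationaryFrom N) :
    ∃ j, ∀ᶠ n in atTop, ∀ (s : S) (ω ζ : B.InfPath), ω.trunc (n + j) = ζ.trunc (n + j) →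
      (A.act s ω).trunc n = (A.act s ζ).trunc n := by
  have hfin := hst.finite_infBoundary
  obtain ⟨j, hnear⟩ := hst.exists_mem_infBoundary
  obtain ⟨K, hK⟩ := (eventually_injOn_trunc hfin).exists
  have hcont : ∀ᶠ n in atTop, ∀ s, ∀ ξ ∈ P.infBoundary, ∀ ζ : B.InfPath,
      ζ.trunc n = ξ.trunc n → (A.act s ζ).trunc K = (A.act s ξ).trunc K :=
    eventually_all.2 fun s => (eventually_all_finite hfin).2 fun ξ _ =>
      (hasAntitoneBasis_nhds ξ).eventually_subset
        ((A.act s).continuous.continuousAt.eventually (eventually_trunc_eq K _))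
  refine ⟨j, ?_⟩
  filter_upwards [hnear, hcont, eventually_ge_atTop K] with n hn hc hKn s ω ζ h
  have hle : n ≤ n + j := Nat.le_add_right n j
  rcases A.tileEdge_or_mem_boundary hP (n + j) s ω with hω | ⟨hω, hωs⟩
  · rw [h] at hω
    exact trunc_eq_of_le hle (A.act_tileEdge hω).1.symm
  rcases A.tileEdge_or_mem_boundary hP (n + j) s ζ with hζ | ⟨-, hζs⟩
  · rw [← h] at hζ
    exact trunc_eq_of_le hle (A.act_tileEdge hζ).1
  obtain ⟨ξ, hξ, hωξ⟩ := hn ω hω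
  obtain ⟨ξ₁, hξ₁, hωξ₁⟩ := hn _ hωs
  obtain ⟨ξ₂, hξ₂, hζξ₂⟩ := hn _ hζs
  have hζξ : ζ.trunc n = ξ.trunc n := (trunc_eq_of_le hle h).symm.trans hωξ
  have hξ₁₂ : ξ₁ = ξ₂ := hK hξ₁ hξ₂ <| by
    rw [← trunc_eq_of_le hKn hωξ₁, ← trunc_eq_of_le hKn hζξ₂, hc s ξ hξ ω hωξ, hc s ξ hξ ζ hζξ]
  rw [hωξ₁, hζξ₂, hξ₁₂]

theorem exists_word_modulus [Finite V] [Finite E] [Finite S] (hP : P.IsTileInflation)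
    (hst : P.BoundaryStationaryFrom N) (L : ℕ) :
    ∃ j, ∀ᶠ n in atTop, ∀ w : List S, w.length ≤ L → ∀ ω ζ : B.InfPath,
      ω.trunc (n + j) = ζ.trunc (n + j) → (A.word w ω).trunc n = (A.word w ζ).trunc n := by
  induction L with
  | zero =>
    refine ⟨0, Eventually.of_forall fun n w hw ω ζ h => ?_⟩
    rw [List.eq_nil_of_length_eq_zero (Nat.le_zero.1 hw)]
    exact h
  | succ L ih =>
    obtain ⟨i, hi⟩ := A.exists_act_modulus hP hst
    obtain ⟨j, hj⟩ := ih
    refine ⟨i + j, ?_⟩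
    filter_upwards [hi, (tendsto_add_atTop_nat i).eventually hj] with n hact hword w hw ω ζ h
    rcases w.eq_nil_or_concat' with rfl | ⟨w, s, rfl⟩
    · exact trunc_eq_of_le (Nat.le_add_right n _) h
    · rw [← add_assoc] at h
      rw [List.length_append, List.length_singleton] at hw
      rw [word_concat, word_concat]
      exact hact s _ _ (hword w (by omega) ω ζ h)

end Continuity

section Germs

theorem eventually_trajectory (w : List S) (ξ : B.InfPath) (n : ℕ) :
    ∀ᶠ ζ in 𝓝 ξ, ∀ i ≤ w.length,
      (A.word (w.take i) ζ).trunc n = (A.word (w.take i) ξ).trunc n :=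
  (Set.finite_Iic w.length).eventually_all.2 fun i _ =>
    (A.word (w.take i)).continuous.continuousAt.eventually (eventually_trunc_eq n _)

theorem word_eventuallyEq_of_sectionAlong_eq {ξ : B.InfPath} {w w' : List S} {n : ℕ}
    (h : A.word w ξ = A.word w' ξ) (hs : A.sectionAlong w ξ n = A.sectionAlong w' ξ n) :
    A.word w =ᶠ[𝓝 ξ] A.word w' := by
  filter_upwards [A.eventually_trajectory w ξ n, A.eventually_trajectory w' ξ n] with ζ hζ hζ'
  have hmem : (ζ.drop n, (A.word w ζ).drop n) ∈ A.sectionAlong w' ξ n := hs ▸ ⟨ζ, hζ, rfl⟩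
  obtain ⟨η, hη, heq⟩ := hmem
  obtain ⟨hdrop, hdrop'⟩ := Prod.mk.inj heq
  obtain rfl : ζ = η :=
    ext_trunc_drop ((hζ 0 (Nat.zero_le _)).trans (hη 0 (Nat.zero_le _)).symm) hdrop
  have hlast := hζ w.length le_rfl
  have hlast' := hζ' w'.length le_rfl
  rw [List.take_length] at hlast hlast'
  exact ext_trunc_drop (by rw [hlast, hlast', h]) hdrop'

/-- Among sufficiently many words, two have the same image of `ξ` in `X` and the same section at
`ξ` on a common deep level, hence the same germ. -/
theorem IsContracting.exists_finite_representatives (hc : A.IsContracting) {X : Set B.InfPath}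
    (hX : X.Finite) (ξ : B.InfPath) :
    ∃ U : Set (List S), U.Finite ∧
      ∀ w, A.word w ξ ∈ X → ∃ u ∈ U, A.word w =ᶠ[𝓝 ξ] A.word u := by
  obtain ⟨𝒩, h𝒩, hlevel⟩ := hc
  choose k hk using hlevel
  let germ : List S → Germ (𝓝 ξ) B.InfPath := fun w => (A.word w : B.InfPath → B.InfPath)
  obtain ⟨U, hUX, hbij⟩ := Set.exists_subset_bijOn {w | A.word w ξ ∈ X} germ
  refine ⟨U, ?_, fun w hw => ?_⟩
  · by_contra hinf
    obtain ⟨F, hFU, hF⟩ := Set.Infinite.exists_subset_card_eq hinf ((X ×ˢ 𝒩).ncard + 1)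
    let n := F.sup k
    have hcard : (X ×ˢ 𝒩).ncard < (F : Set (List S)).ncard := by
      rw [Set.ncard_coe_finset, hF]
      exact Nat.lt_succ_self _
    obtain ⟨w, hw, w', hw', hne, heq⟩ := Set.exists_ne_map_eq_of_ncard_lt_of_maps_to hcard
      (f := fun w => (A.word w ξ, A.sectionAlong w ξ n))
      (fun w hw => ⟨hUX (hFU hw), hk w n (Finset.le_sup hw) ξ⟩) (hX.prod h𝒩)
    obtain ⟨himage, hsection⟩ := Prod.mk.inj heq
    exact hne (hbij.injOn (hFU hw) (hFU hw')
      (Germ.coe_eq.2 (A.word_eventuallyEq_of_sectionAlong_eq himage hsection)))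
  · obtain ⟨u, hu, hgerm⟩ := hbij.surjOn ⟨w, hw, rfl⟩
    exact ⟨u, hu, Germ.coe_eq.1 hgerm.symm⟩

theorem IsContracting.exists_finite_words (hc : A.IsContracting) {X : Set B.InfPath}
    (hX : X.Finite) :
    ∃ U : Set (List S), U.Finite ∧ [] ∈ U ∧ ∀ W : Set (List S), W.Finite →
      ∀ᶠ K in atTop, ∀ ξ ∈ X, ∀ w ∈ W,
        (∃ u ∈ U, ∀ ζ : B.InfPath, ζ.trunc K = ξ.trunc K → A.word w ζ = A.word u ζ) ∨
        ∀ ζ : B.InfPath, ζ.trunc K = ξ.trunc K →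
          ∀ ξ' ∈ X, (A.word w ζ).trunc K ≠ ξ'.trunc K := by
  choose R hR hgerm using IsContracting.exists_finite_representatives A hc hX
  refine ⟨insert [] (⋃ ξ ∈ X, R ξ), (hX.biUnion fun ξ _ => hR ξ).insert _,
    Set.mem_insert _ _, fun W hW => ?_⟩
  refine (eventually_all_finite hX).2 fun ξ hξ => (eventually_all_finite hW).2 fun w _ => ?_
  by_cases hw : A.word w ξ ∈ X
  · obtain ⟨u, hu, hwu⟩ := hgerm ξ w hw
    exact ((hasAntitoneBasis_nhds ξ).eventually_subset hwu).mono fun K hK =>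
      Or.inl ⟨u, Or.inr (Set.mem_biUnion hξ hu), fun ζ hζ => hK hζ⟩
  · exact (eventually_forall_trunc_ne (A.word w).continuous.continuousAt hX hw).mono
      fun K hK => Or.inr hK

/-- The words in `U` describe the action near the boundary points of level `n`, and the first
`n + m` edges of a path determine the first `n` edges of its images under `U · S`. -/
structure IsGermSystem (U : Set (List S)) (m n : ℕ) : Prop where
  nil_mem : [] ∈ U
  trunc_eq : ∀ u ∈ U, ∀ (s : S) (ω ζ : B.InfPath), ω.trunc (n + m) = ζ.trunc (n + m) →
    (A.word (u ++ [s]) ω).trunc n = (A.word (u ++ [s]) ζ).trunc n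
  exists_eq : ∀ u ∈ U, ∀ (s : S) (ω : B.InfPath), ω.trunc n ∈ P.boundary n →
    (A.word (u ++ [s]) ω).trunc n ∈ P.boundary n →
    ∃ u' ∈ U, ∀ ζ : B.InfPath, ζ.trunc n = ω.trunc n → A.word (u ++ [s]) ζ = A.word u' ζ

theorem exists_isGermSystem [Finite V] [Finite E] [Finite S] (hP : P.IsTileInflation) {N : ℕ}
    (hst : P.BoundaryStationaryFrom N) (hc : A.IsContracting) :
    ∃ (U : Set (List S)) (m : ℕ), U.Finite ∧ ∀ᶠ n in atTop, A.IsGermSystem U m n := by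
  obtain ⟨U, hU, hnil, hgerm⟩ := IsContracting.exists_finite_words A hc hst.finite_infBoundary
  obtain ⟨j, hnear⟩ := hst.exists_mem_infBoundary
  have hUS : (Set.image2 (fun u s => u ++ [s]) U (Set.univ : Set S)).Finite :=
    hU.image2 _ Set.finite_univ
  obtain ⟨K, hK, hnearK⟩ := ((hgerm _ hUS).and hnear).exists
  obtain ⟨L, hL⟩ := (hU.image List.length).bddAbove
  obtain ⟨m, hm⟩ := A.exists_word_modulus hP hst (L + 1)
  refine ⟨U, m, hU, ?_⟩
  filter_upwards [hm, eventually_ge_atTop (K + j)] with n hn hKn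
  refine ⟨hnil, fun u hu s => hn _ ?_, fun u hu s ω hω hωs => ?_⟩
  · rw [List.length_append, List.length_singleton]
    exact Nat.succ_le_succ (hL ⟨u, hu, rfl⟩)
  · obtain ⟨ξ, hξ, hωξ⟩ := hnearK ω (trunc_mem_boundary_of_le hKn hω)
    obtain ⟨ξ', hξ', hωξ'⟩ := hnearK _ (trunc_mem_boundary_of_le hKn hωs)
    rcases hK ξ hξ _ (Set.mem_image2_of_mem hu (Set.mem_univ s)) with ⟨u', hu', heq⟩ | hne
    · exact ⟨u', hu', fun ζ hζ => heq ζ ((trunc_eq_of_le (by omega) hζ).trans hωξ)⟩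
    · exact (hne ω hωξ ξ' hξ' hωξ').elim

end Germs

end PerfectAction

end Action

theorem exists_last_lt {p : ℕ → Prop} {a b : ℕ} (ha : p a) (hab : a < b) :
    ∃ c, a ≤ c ∧ c < b ∧ p c ∧ ∀ r, c < r → r < b → ¬p r := by
  classical
  have hle := Nat.findGreatest_le (P := p) (b - 1)
  exact ⟨Nat.findGreatest p (b - 1), Nat.le_findGreatest (by omega) ha, by omega,
    Nat.findGreatest_spec (by omega) ha,
    fun r hr hrb => Nat.findGreatest_is_greatest hr (by omega)⟩

/-- The sequence `γ` of vertices of tiles of level `n` traverses a tile between the times `a`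
and `b`. -/
structure IsTraverse (P : B.Connectors S) (n : ℕ) (γ : ℕ → B.FinPath n) (a b : ℕ) : Prop where
  add_two_le : a + 2 ≤ b
  start_mem : γ a ∈ P.boundary n
  end_mem : γ b ∈ P.boundary n
  start_ne_end : γ a ≠ γ b
  notMem : ∀ r, a < r → r < b → γ r ∉ P.boundary n

/-- The sequence `γ` of vertices of tiles of level `n` never passes directly from a boundary point
to a boundary point between the times `a` and `b`. -/
def IsExcursion (P : B.Connectors S) (n : ℕ) (γ : ℕ → B.FinPath n) (a b : ℕ) : Prop :=
  ∀ r, a ≤ r → r < b → γ r ∉ P.boundary n ∨ γ (r + 1) ∉ P.boundary n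

theorem isExcursion_of_forall_notMem {n : ℕ} {γ : ℕ → B.FinPath n} {a b : ℕ}
    (h : ∀ r, a < r → r < b → γ r ∉ P.boundary n)
    (hend : a + 1 = b → γ a ∉ P.boundary n ∨ γ b ∉ P.boundary n) : P.IsExcursion n γ a b := by
  intro r har hrb
  rcases har.lt_or_eq with har | rfl
  · exact Or.inl (h r har hrb)
  rcases (Nat.succ_le_of_lt hrb).lt_or_eq with hrb | rfl
  · exact Or.inr (h _ a.lt_succ_self hrb)
  · exact hend rfl

theorem IsTraverse.isExcursion {n : ℕ} {γ : ℕ → B.FinPath n} {a b : ℕ}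
    (h : P.IsTraverse n γ a b) : P.IsExcursion n γ a b :=
  have hle := h.add_two_le
  isExcursion_of_forall_notMem h.notMem fun _ => by omega

namespace PerfectAction

variable [InvolutiveInv S] (A : PerfectAction P)

/-- The vertex at time `k` of the trajectory of `ω` under the word `v` in the tiles of level
`n`. -/
def pos (v : List S) (n : ℕ) (ω : B.InfPath) (k : ℕ) : B.FinPath n :=
  (A.word (v.take k) ω).trunc n

/-- On the paths that share `n + m` edges with `ω`, the first `q` letters of `v` act by replacing
the beginning by `b` and then applying a word from `U`. -/
def ActsAsGerm (U : Set (List S)) (m n : ℕ) (v : List S) (ω : B.InfPath) (b : B.FinPath n)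
    (q : ℕ) : Prop :=
  ∃ u ∈ U, ∀ ω' : B.InfPath, ω'.trunc (n + m) = ω.trunc (n + m) →
    A.pos v n ω' q = A.pos v n ω q ∧ A.word (v.take q) ω' = A.word u (replace b ω')

variable {A} {n m : ℕ} {v : List S} {ω ω' : B.InfPath}

theorem tileEdge_pos (hP : P.IsTileInflation) {k : ℕ} {s : S} (hs : v[k]? = some s)
    (h : A.pos v n ω k ∉ P.boundary n ∨ A.pos v n ω (k + 1) ∉ P.boundary n) :
    P.TileEdge n s (A.pos v n ω k) (A.pos v n ω (k + 1)) := by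
  have hor := A.tileEdge_or_mem_boundary hP n s (A.word (v.take k) ω)
  rw [← A.word_take_succ v hs] at hor
  exact hor.resolve_right fun hmem => h.elim (· hmem.1) (· hmem.2)

theorem pos_eq_and_drop_eq (hP : P.IsTileInflation) {a b : ℕ} (hab : a ≤ b) (hb : b ≤ v.length)
    (h : P.IsExcursion n (A.pos v n ω) a b) (hω : A.pos v n ω' a = A.pos v n ω a) :
    A.pos v n ω' b = A.pos v n ω b ∧
      (A.word (v.take b) ω').drop n = (A.word (v.take a) ω').drop n := by
  induction b, hab using Nat.le_induction with
  | base => exact ⟨hω, rfl⟩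
  | succ b hab ih =>
    have hs : v[b]? = some v[b] := List.getElem?_eq_getElem hb
    obtain ⟨hpos, hdrop⟩ := ih (by omega) fun r har hrb => h r har (by omega)
    have hedge := tileEdge_pos hP hs (h b hab b.lt_succ_self)
    rw [← hpos] at hedge
    have hact := A.act_tileEdge hedge
    rw [← A.word_take_succ v hs] at hact
    exact ⟨hact.1, hact.2.trans hdrop⟩

variable {U : Set (List S)} {q : ℕ}

theorem pos_zero_eq (h : ω'.trunc (n + m) = ω.trunc (n + m)) :
    A.pos v n ω' 0 = A.pos v n ω 0 :=
  trunc_eq_of_le (Nat.le_add_right n m) h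

theorem actsAsGerm_of_isExcursion (hP : P.IsTileInflation) (hU : [] ∈ U) (hq : q ≤ v.length)
    (h : P.IsExcursion n (A.pos v n ω) 0 q) : A.ActsAsGerm U m n v ω (A.pos v n ω q) q := by
  refine ⟨[], hU, fun ω' hω' => ?_⟩
  obtain ⟨hpos, hdrop⟩ := pos_eq_and_drop_eq hP q.zero_le hq h (pos_zero_eq hω')
  exact ⟨hpos, (replace_eq hpos hdrop).symm⟩

theorem last_pos_eq (hP : P.IsTileInflation) (hq : q ≤ v.length)
    (h : P.IsExcursion n (A.pos v n ω) 0 q) : (A.pos v n ω q).last = (ω.trunc n).last := by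
  have hdrop := (pos_eq_and_drop_eq hP q.zero_le hq h rfl).2
  exact congrArg B.src (drop_eq_iff.1 hdrop n le_rfl)

variable {b : B.FinPath n}

theorem ActsAsGerm.succ (hU : A.IsGermSystem U m n) (hb : b ∈ P.boundary n)
    (hlast : b.last = (ω.trunc n).last) (hq : q < v.length)
    (hmem : A.pos v n ω (q + 1) ∈ P.boundary n) (h : A.ActsAsGerm U m n v ω b q) :
    A.ActsAsGerm U m n v ω b (q + 1) := by
  obtain ⟨u, hu, hword⟩ := h
  have hs : v[q]? = some v[q] := List.getElem?_eq_getElem hq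
  have hsucc : ∀ ω' : B.InfPath, ω'.trunc (n + m) = ω.trunc (n + m) →
      A.word (v.take (q + 1)) ω' = A.word (u ++ [v[q]]) (replace b ω') := fun ω' hω' => by
    rw [A.word_take_succ v hs, (hword ω' hω').2, word_concat]
  have htrunc : ∀ ω' : B.InfPath, ω'.trunc (n + m) = ω.trunc (n + m) →
      (replace b ω').trunc n = b := fun ω' hω' =>
    trunc_replace (hlast.trans (congrArg FinPath.last (trunc_add_eq_iff.1 hω').1).symm)
  rw [pos, hsucc ω rfl] at hmem
  obtain ⟨u', hu', hgerm⟩ := hU.exists_eq u hu v[q] (replace b ω) ((htrunc ω rfl).symm ▸ hb) hmem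
  refine ⟨u', hu', fun ω' hω' => ⟨?_, ?_⟩⟩
  · rw [pos, pos, hsucc ω' hω', hsucc ω rfl]
    refine hU.trunc_eq u hu _ _ _ (trunc_add_eq_iff.2 ⟨?_, ?_⟩)
    · rw [htrunc ω' hω', htrunc ω rfl]
    · rw [drop_replace, drop_replace, (trunc_add_eq_iff.1 hω').2]
  · rw [hsucc ω' hω']
    exact hgerm _ ((htrunc ω' hω').trans (htrunc ω rfl).symm)

theorem ActsAsGerm.of_return (hP : P.IsTileInflation) {q' : ℕ} (hqq' : q ≤ q')
    (hq' : q' ≤ v.length) (hexc : P.IsExcursion n (A.pos v n ω) q q')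
    (hreturn : A.pos v n ω q = A.pos v n ω q') (h : A.ActsAsGerm U m n v ω b q) :
    A.ActsAsGerm U m n v ω b q' := by
  obtain ⟨u, hu, hword⟩ := h
  refine ⟨u, hu, fun ω' hω' => ?_⟩
  obtain ⟨hpos, heq⟩ := hword ω' hω'
  obtain ⟨hpos', hdrop⟩ := pos_eq_and_drop_eq hP hqq' hq' hexc hpos
  refine ⟨hpos', (ext_trunc_drop ?_ hdrop).trans heq⟩
  exact hpos'.trans (hreturn.symm.trans hpos.symm)

/-- Between two consecutive visits to the boundary the trajectory makes a single step, or it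
traverses a tile, or it returns to where it left the boundary. -/
theorem actsAsGerm_of_no_traverse (hP : P.IsTileInflation) (hU : A.IsGermSystem U m n) {q₀ : ℕ}
    (hq₀ : A.pos v n ω q₀ ∈ P.boundary n)
    (hfirst : ∀ r < q₀, A.pos v n ω r ∉ P.boundary n) (hle : q₀ ≤ q) (hq : q ≤ v.length)
    (hmem : A.pos v n ω q ∈ P.boundary n)
    (hno : ∀ k l, P.IsTraverse n (A.pos v n ω) k l → q < l) :
    A.ActsAsGerm U m n v ω (A.pos v n ω q₀) q := by
  have hexc₀ : P.IsExcursion n (A.pos v n ω) 0 q₀ := fun r _ hr => Or.inl (hfirst r hr)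
  induction q using Nat.strong_induction_on with
  | _ q ih =>
    rcases hle.lt_or_eq with hlt | rfl
    · obtain ⟨a, hle_a, ha, hmem_a, hbetween⟩ :=
        exists_last_lt (p := fun r => A.pos v n ω r ∈ P.boundary n) hq₀ hlt
      have hgerm := ih a ha hle_a (by omega) hmem_a fun k l hkl => ha.trans (hno k l hkl)
      rcases (Nat.succ_le_of_lt ha).lt_or_eq with hgap | rfl
      · refine hgerm.of_return hP ha.le hq
          (isExcursion_of_forall_notMem hbetween fun h => by omega) ?_
        by_contra hne
        exact lt_irrefl q (hno a q ⟨hgap, hmem_a, hmem, hne, hbetween⟩)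
      · exact hgerm.succ hU hq₀ (last_pos_eq hP (by omega) hexc₀) hq hmem
    · exact actsAsGerm_of_isExcursion hP hU.nil_mem hq hexc₀

theorem exists_word_take_eq_replace (hP : P.IsTileInflation) (hU : A.IsGermSystem U m n) {p : ℕ}
    (hp : p ≤ v.length) (hno : ∀ k l, P.IsTraverse n (A.pos v n ω) k l → p ≤ l) :
    ∃ b : B.FinPath n, ∃ u ∈ U, ∀ ω' : B.InfPath, ω'.trunc (n + m) = ω.trunc (n + m) →
      A.pos v n ω' p = A.pos v n ω p ∧
        A.word (v.take p) ω' = replace (A.pos v n ω p) (A.word u (replace b ω')) := by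
  classical
  suffices ∃ (b : B.FinPath n) (q : ℕ), q ≤ p ∧ A.ActsAsGerm U m n v ω b q ∧
      P.IsExcursion n (A.pos v n ω) q p by
    obtain ⟨b, q, hqp, ⟨u, hu, hword⟩, hexc⟩ := this
    refine ⟨b, u, hu, fun ω' hω' => ?_⟩
    obtain ⟨hpos, heq⟩ := hword ω' hω'
    obtain ⟨hpos', hdrop⟩ := pos_eq_and_drop_eq hP hqp hp hexc hpos
    exact ⟨hpos', (replace_eq hpos' (hdrop.trans (congrArg _ heq))).symm⟩
  by_cases hvisit : ∃ r, r < p ∧ A.pos v n ω r ∈ P.boundary n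
  · obtain ⟨hq₀, hmem₀⟩ := Nat.find_spec hvisit
    have hfirst : ∀ r < Nat.find hvisit, A.pos v n ω r ∉ P.boundary n :=
      fun r hr hmem => Nat.find_min hvisit hr ⟨hr.trans hq₀, hmem⟩
    obtain ⟨a, hle, ha, hmem_a, hbetween⟩ :=
      exists_last_lt (p := fun r => A.pos v n ω r ∈ P.boundary n) hmem₀ hq₀
    have hgerm := actsAsGerm_of_no_traverse hP hU hmem₀ hfirst hle (by omega) hmem_a
      fun k l hkl => ha.trans_le (hno k l hkl)
    by_cases hstep : a + 1 = p ∧ A.pos v n ω p ∈ P.boundary n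
    · obtain ⟨rfl, hmem⟩ := hstep
      have hlast := last_pos_eq (A := A) hP (by omega) fun r _ hr => Or.inl (hfirst r hr)
      exact ⟨_, a + 1, le_rfl, hgerm.succ hU hmem₀ hlast hp hmem, fun r h h' => by omega⟩
    · exact ⟨_, a, ha.le, hgerm, isExcursion_of_forall_notMem hbetween
        fun h => Or.inr fun hmem => hstep ⟨h, hmem⟩⟩
  · push Not at hvisit
    exact ⟨_, 0, p.zero_le, actsAsGerm_of_isExcursion hP hU.nil_mem v.length.zero_le
      fun r _ hr => absurd hr r.not_lt_zero, fun r _ hr => Or.inl (hvisit r hr)⟩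

end PerfectAction

theorem finite_traverses [Finite V] [Finite E] (P : B.Connectors S) (w : List S) (n : ℕ) (v : V) :
    (P.traverses w n v).Finite := by
  refine ((Set.finite_Iic w.length).prod ((Set.finite_Iic w.length).prod
    (Set.finite_univ (α := B.FinPath n)))).subset ?_
  rintro ⟨k, l, γ⟩ ⟨-, hkl, -⟩
  change k + l ≤ w.length at hkl
  exact ⟨(Nat.le_add_right k l).trans hkl, (Nat.le_add_left l k).trans hkl, Set.mem_univ γ⟩

namespace PerfectAction

variable [InvolutiveInv S] (A : PerfectAction P)

/-- The times and places at which the traverses of tiles of level `n` by the word `w` end. -/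
def traverseEnds (w : List S) (n : ℕ) : Set (ℕ × B.FinPath n) :=
  {e | ∃ ω k, e.1 ≤ w.length ∧ P.IsTraverse n (A.pos w n ω) k e.1 ∧ A.pos w n ω e.1 = e.2}

variable {A} {n : ℕ} {w : List S}

theorem pos_word_take (ω : B.InfPath) (i r : ℕ) :
    A.pos (w.drop i) n (A.word (w.take i) ω) r = A.pos w n ω (i + r) := by
  rw [pos, pos, ← word_append, List.take_add]

theorem mem_traverseEnds_of_drop {i k l : ℕ} {ω : B.InfPath} (hl : i + l ≤ w.length)
    (h : P.IsTraverse n (A.pos (w.drop i) n ω) k l) :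
    (i + l, A.pos (w.drop i) n ω l) ∈ A.traverseEnds w n := by
  obtain ⟨ω, rfl⟩ := (A.word (w.take i)).surjective ω
  obtain ⟨hkl, hk, hl', hne, hbetween⟩ := h
  simp only [pos_word_take] at hk hl' hne hbetween ⊢
  refine ⟨ω, i + k, hl, ⟨by omega, hk, hl', hne, fun r hkr hrl => ?_⟩, rfl⟩
  obtain ⟨r, rfl⟩ := Nat.exists_eq_add_of_le (show i ≤ r by omega)
  exact hbetween r (by omega) (by omega)

theorem mem_traverses (hP : P.IsTileInflation) {ω : B.InfPath} {k l : ℕ}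
    (hl : k + l ≤ w.length) (h : P.IsTraverse n (A.pos w n ω) k (k + l)) :
    (k, l, A.pos w n ω k) ∈ P.traverses w n (A.pos w n ω k).last := by
  have hkl := h.add_two_le
  refine ⟨show 2 ≤ l by omega, hl, fun r => A.pos w n ω (k + r), rfl, rfl, fun r hr => ?_,
    h.start_mem, h.end_mem, h.start_ne_end, fun r h0 hr => h.notMem _ (by omega) ?_⟩
  · have hlt : k + r < k + l := Nat.add_lt_add_left hr k
    have hs : w[k + r]? = some w[k + r] := List.getElem?_eq_getElem (hlt.trans_le hl)
    exact ⟨_, hs, tileEdge_pos hP hs (h.isExcursion _ (Nat.le_add_right k r) hlt)⟩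
  · exact Nat.add_lt_add_left hr k

/-- A traverse is determined by its starting point and its subword, hence so is its end. -/
theorem ncard_traverseEnds_le [Fintype V] [Nonempty V] [Finite E] (hP : P.IsTileInflation) :
    (A.traverseEnds w n).ncard ≤ P.traverseCount w n := by
  have hfin : (⋃ v, P.traverses w n v).Finite :=
    Set.finite_iUnion fun v => finite_traverses P w n v
  have htraverse : ∀ e ∈ A.traverseEnds w n, ∃ (ω : B.InfPath) (k l : ℕ), k + l = e.1 ∧
      e.1 ≤ w.length ∧ P.IsTraverse n (A.pos w n ω) k e.1 ∧ A.pos w n ω e.1 = e.2 := by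
    rintro e ⟨ω, k, hle, h, heq⟩
    exact ⟨ω, k, e.1 - k, by have := h.add_two_le; omega, hle, h, heq⟩
  choose! ω k l hkl hle h hend using htraverse
  refine (Set.ncard_le_ncard_of_injOn (fun e => (k e, l e, A.pos w n (ω e) (k e)))
    (fun e he => ?_) (fun e he e' he' heq => ?_) hfin).trans
    (Set.ncard_iUnion_le_of_fintype _)
  · have he' := h e he
    rw [← hkl e he] at he'
    exact Set.mem_iUnion.2 ⟨_, mem_traverses hP ((hkl e he).trans_le (hle e he)) he'⟩
  · obtain ⟨hk, hl, hpos⟩ : k e = k e' ∧ l e = l e' ∧ A.pos w n (ω e) (k e) =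
        A.pos w n (ω e') (k e') := by simpa only [Prod.mk.injEq] using heq
    have htime : e.1 = e'.1 := by rw [← hkl e he, ← hkl e' he', hk, hl]
    refine Prod.ext htime ?_
    rw [← hend e he, ← hend e' he', ← htime]
    have hle_end := (h e he).add_two_le
    exact ((pos_eq_and_drop_eq hP (by omega) (hle e he) (h e he).isExcursion
      (by rw [hpos, hk])).1).symm

theorem exists_fin_range_superset {α : Type*} [Nonempty α] {s : Set α} (hs : s.Finite) {T : ℕ}
    (hT : s.ncard ≤ T) : ∃ d : Fin T → α, s ⊆ Set.range d := by
  have := hs.fintype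
  have hcard : Fintype.card s ≤ Fintype.card (Fin T) := by
    rwa [← Nat.card_eq_fintype_card, Nat.card_coe_set_eq, Fintype.card_fin]
  obtain ⟨i⟩ := Function.Embedding.nonempty_of_card_le hcard
  exact ⟨Function.extend i Subtype.val fun _ => Classical.arbitrary α,
    fun x hx => ⟨i ⟨x, hx⟩, i.injective.extend_apply _ _ _⟩⟩

/-- The moves of the transducers that compute words: replace the first `n` edges, apply a word from
`U`, and replace the first `n` edges again. -/
noncomputable def germMove (A : PerfectAction P) {U : Set (List S)} {n : ℕ}
    (c : B.FinPath n × U × B.FinPath n) (ω : B.InfPath) : B.InfPath :=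
  replace c.2.2 (A.word c.2.1 (replace c.1 ω))

variable {m i : ℕ} {U : Set (List S)}

/-- The witness `p` is the time of the first end of a traverse. -/
theorem exists_take_eq_germMove (hP : P.IsTileInflation) (hU : A.IsGermSystem U m n)
    (hi : i ≤ w.length) (ω : B.InfPath) :
    ∃ p, i + p ≤ w.length ∧
      (i + p = w.length ∨ 0 < p ∧ (i + p, A.pos (w.drop i) n ω p) ∈ A.traverseEnds w n) ∧
      ∃ c : B.FinPath n × U × B.FinPath n, ∀ ω' : B.InfPath, ω'.trunc (n + m) = ω.trunc (n + m) →
        A.pos (w.drop i) n ω' p = A.pos (w.drop i) n ω p ∧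
          A.word ((w.drop i).take p) ω' = A.germMove c ω' := by
  classical
  suffices ∃ p, i + p ≤ w.length ∧
      (i + p = w.length ∨ 0 < p ∧ (i + p, A.pos (w.drop i) n ω p) ∈ A.traverseEnds w n) ∧
      ∀ k l, P.IsTraverse n (A.pos (w.drop i) n ω) k l → p ≤ l by
    obtain ⟨p, hp, hend, hno⟩ := this
    obtain ⟨b, u, hu, hword⟩ :=
      exists_word_take_eq_replace hP hU (by rw [List.length_drop]; omega) hno
    exact ⟨p, hp, hend, (b, ⟨u, hu⟩, _), hword⟩
  by_cases h : ∃ l, i + l ≤ w.length ∧ ∃ k, P.IsTraverse n (A.pos (w.drop i) n ω) k l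
  · obtain ⟨hle, k, htraverse⟩ := Nat.find_spec h
    have hkl := htraverse.add_two_le
    refine ⟨Nat.find h, hle, Or.inr ⟨by omega, mem_traverseEnds_of_drop hle htraverse⟩,
      fun k' l htraverse' => ?_⟩
    rcases le_or_gt (i + l) w.length with hl | hl
    · exact Nat.find_min' h ⟨hl, k', htraverse'⟩
    · omega
  · refine ⟨w.length - i, by omega, Or.inl (by omega), fun k l htraverse => ?_⟩
    by_contra hl
    exact h ⟨l, by omega, k, htraverse⟩

/-- A state `a` of the transducer stands for the remaining part of `w` from the time `(d a).1` on,
applied to a path that is in position `(d a).2` at this time. -/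
theorem exists_isCorrectAt (hP : P.IsTileInflation) (hU : A.IsGermSystem U m n) {Q : Type*}
    {d : Q → ℕ × B.FinPath n} (hd : A.traverseEnds w n ⊆ Set.range d) {a : Q} {ω : B.InfPath}
    (hle : (d a).1 ≤ w.length) (htrunc : ω.trunc n = (d a).2) :
    ∃ instruction : (B.FinPath n × U × B.FinPath n) × Option Q, ∀ ω' : B.InfPath,
      (d a).1 ≤ w.length ∧ ω'.trunc n = (d a).2 → (ω'.drop n).trunc m = (ω.drop n).trunc m →
        Transducer.IsCorrectAt A.germMove (fun a => A.word (w.drop (d a).1))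
          (fun a ω => (d a).1 ≤ w.length ∧ ω.trunc n = (d a).2)
          (fun a => w.length - (d a).1) a ω' instruction := by
  obtain ⟨p, hp, hend, c, hword⟩ := exists_take_eq_germMove hP hU hle ω
  have hnear : ∀ ω' : B.InfPath, ω'.trunc n = (d a).2 →
      (ω'.drop n).trunc m = (ω.drop n).trunc m → ω'.trunc (n + m) = ω.trunc (n + m) :=
    fun ω' htrunc' hread => trunc_add_eq_iff.2 ⟨htrunc'.trans htrunc.symm, hread⟩
  have hrest : ∀ ω' : B.InfPath, A.word (w.drop ((d a).1 + p))
      (A.word ((w.drop (d a).1).take p) ω') = A.word (w.drop (d a).1) ω' := fun ω' => by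
    rw [← word_append, ← List.drop_drop, List.take_append_drop]
  rcases hend with hend | ⟨hpos, hmem⟩
  · refine ⟨(c, none), fun ω' hω' hread => ⟨fun _ => ?_, nofun⟩⟩
    beta_reduce
    rw [← (hword ω' (hnear ω' hω'.2 hread)).2, ← hrest ω', hend, List.drop_length, word_nil]
  · obtain ⟨a', ha'⟩ := hd hmem
    refine ⟨(c, some a'), fun ω' hω' hread => ⟨nofun, ?_⟩⟩
    obtain ⟨hpos', hmove⟩ := hword ω' (hnear ω' hω'.2 hread)
    rintro _ ⟨⟩
    beta_reduce
    rw [← hmove, ha']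
    exact ⟨⟨hp, hpos'⟩, by omega, hrest ω'⟩

theorem exists_transducer [Fintype V] [Nonempty V] [Finite E] (hP : P.IsTileInflation)
    (hU : A.IsGermSystem U m n) {T : ℕ} (hT : P.traverseCount w n ≤ T) :
    ∃ t : Transducer (B.FinPath n ⊕ Fin T) (B.FinPath m) (B.FinPath n × U × B.FinPath n),
      ∀ ω : B.InfPath, t.Computes (fun ω => (ω.drop n).trunc m) A.germMove
        (Sum.inl (ω.trunc n)) ω (A.word w ω) := by
  have : Nonempty U := ⟨⟨[], hU.nil_mem⟩⟩
  have hfin : (A.traverseEnds w n).Finite :=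
    ((Set.finite_Iic w.length).prod Set.finite_univ).subset fun e ⟨_, _, he, _⟩ =>
      ⟨he, Set.mem_univ e.2⟩
  obtain ⟨ends, hends⟩ := exists_fin_range_superset hfin ((ncard_traverseEnds_le hP).trans hT)
  obtain ⟨t, ht⟩ := Transducer.exists_computes fun _ _ hI => exists_isCorrectAt hP hU
    (d := Sum.elim (fun γ => (0, γ)) ends)
    (fun e he => (hends he).elim fun j hj => ⟨Sum.inr j, hj⟩) hI.1 hI.2
  exact ⟨t, fun ω => ht (Sum.inl (ω.trunc n)) ω ⟨w.length.zero_le, rfl⟩⟩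

theorem growth_le [Fintype V] [Nonempty V] [Finite E] (hP : P.IsTileInflation) (hUf : U.Finite)
    (hU : A.IsGermSystem U m n) {T : ℕ} {R : ℝ}
    (hT : ∀ w : List S, (w.length : ℝ) ≤ R → P.traverseCount w n ≤ T) :
    A.growth R ≤ ((Nat.card (B.FinPath n) * (U.ncard * Nat.card (B.FinPath n)) *
      (Nat.card (B.FinPath n) + T + 1)) ^
        (Nat.card (B.FinPath m) * (Nat.card (B.FinPath n) + T)) : ℕ) := by
  have := hUf.to_subtype
  have hinj : Function.Injective fun (g : A.group) (ω : B.InfPath) => g.1 ω := fun g g' h =>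
    Subtype.ext (Homeomorph.ext (congrFun h))
  have hcard := Transducer.ncard_le_of_computes
    (s := {g : A.group | ∃ w : List S, (w.length : ℝ) ≤ R ∧ A.word w = g}) hinj
    (fun ω => Sum.inl (ω.trunc n)) fun g ⟨w, hw, hg⟩ =>
      (exists_transducer hP hU (hT w hw)).imp fun t ht ω => hg ▸ ht ω
  rw [Nat.card_prod, Nat.card_prod, Nat.card_sum, Nat.card_fin, Nat.card_coe_set_eq] at hcard
  exact Nat.cast_le.2 hcard

end PerfectAction

section TileGrowth

variable [Finite E]

theorem card_finPath_le [Finite V] (n : ℕ) :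
    Nat.card (B.FinPath n) ≤ Nat.card V * Nat.card E ^ n := by
  have hinj : Function.Injective fun p : B.FinPath n => (p.vert 0, p.edge) := fun p q h => by
    obtain ⟨hvert, hedge⟩ := Prod.mk.inj h
    refine FinPath.ext (funext fun i => Fin.cases hvert (fun i => ?_) i) hedge
    rw [← p.rng_edge, ← q.rng_edge, hedge]
  simpa only [Nat.card_prod, Nat.card_fun, Nat.card_fin] using Nat.card_le_card_of_injective _ hinj

theorem sum_card_tile [Fintype V] (n : ℕ) :
    ∑ v : V, Nat.card (Tile B n v) = Nat.card (B.FinPath n) := by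
  rw [← Nat.card_sigma, Nat.card_congr (Equiv.sigmaFiberEquiv FinPath.last)]

theorem isBoundedUnder_card_finPath [Finite V] :
    IsBoundedUnder (· ≤ ·) atTop
      fun n : ℕ => (Nat.card (B.FinPath n) : ℝ) ^ (1 / (n : ℝ)) := by
  refine isBoundedUnder_of_eventually_le (a := (Nat.card V * Nat.card E : ℝ)) ?_
  filter_upwards [eventually_ne_atTop 0] with n hn
  have hcard : Nat.card (B.FinPath n) ≤ (Nat.card V * Nat.card E) ^ n := by
    rw [mul_pow]
    exact (card_finPath_le n).trans (Nat.mul_le_mul_right _ (Nat.le_self_pow hn _))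
  calc (Nat.card (B.FinPath n) : ℝ) ^ (1 / (n : ℝ))
      ≤ ((Nat.card V * Nat.card E : ℝ) ^ n) ^ (1 / (n : ℝ)) := by
        gcongr
        exact_mod_cast hcard
    _ = Nat.card V * Nat.card E := by
        rw [one_div, Real.pow_rpow_inv_natCast (by positivity) hn]

variable [Nonempty V]

theorem one_le_tileGrowthRate [Fintype V] : 1 ≤ tileGrowthRate B := by
  simp only [tileGrowthRate, sum_card_tile]
  exact le_limsup_of_frequently_le (Frequently.of_forall fun _ =>
    Real.one_le_rpow (Nat.one_le_cast.2 Nat.card_pos) (by positivity)) isBoundedUnder_card_finPath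

theorem eventually_card_finPath_le [Fintype V] {l : ℝ} (hl : Real.log (tileGrowthRate B) < l) :
    ∀ᶠ n : ℕ in atTop, (Nat.card (B.FinPath n) : ℝ) ≤ Real.exp (l * n) := by
  have hlimsup : tileGrowthRate B < Real.exp l :=
    (Real.log_lt_iff_lt_exp (zero_lt_one.trans_le one_le_tileGrowthRate)).1 hl
  simp only [tileGrowthRate, sum_card_tile] at hlimsup
  filter_upwards [eventually_lt_of_limsup_lt hlimsup isBoundedUnder_card_finPath,
    eventually_ne_atTop 0] with n hlt hn
  rw [mul_comm, Real.exp_nat_mul]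
  calc (Nat.card (B.FinPath n) : ℝ)
      = ((Nat.card (B.FinPath n) : ℝ) ^ (1 / (n : ℝ))) ^ n := by
        rw [one_div, Real.rpow_inv_natCast_pow (by positivity) hn]
    _ ≤ Real.exp l ^ n := by gcongr

end TileGrowth

theorem PerfectAction.growth_le_one_of_isEmpty [InvolutiveInv S] [IsEmpty V]
    (A : PerfectAction P) (R : ℝ) : A.growth R ≤ 1 := by
  have : IsEmpty B.InfPath := ⟨fun ω => isEmptyElim (B.src (ω.1 0))⟩
  have : Subsingleton A.group :=
    ⟨fun g g' => Subtype.ext (Homeomorph.ext fun ω => isEmptyElim ω)⟩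
  exact Nat.cast_le_one.2 (Set.ncard_le_one_iff_subsingleton.2 Set.subsingleton_of_subsingleton)

theorem traverseCount_le_of_tsum_le [Fintype V] {w : List S} {t C R : ℝ} (ht : 0 < t)
    (hsum : Summable fun n : ℕ => (P.traverseCount w n : ℝ) * t ^ n)
    (hC : ∑' n : ℕ, (P.traverseCount w n : ℝ) * t ^ n ≤ w.length * C) (hw : w.length ≤ R) (n : ℕ) :
    P.traverseCount w n ≤ |C| * (R / t ^ n) := by
  rw [← mul_div_assoc, le_div_iff₀ (pow_pos ht n)]
  calc P.traverseCount w n * t ^ n ≤ ∑' n : ℕ, (P.traverseCount w n : ℝ) * t ^ n :=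
        hsum.le_tsum n fun _ _ => by positivity
    _ ≤ w.length * C := hC
    _ ≤ w.length * |C| := by gcongr; exact le_abs_self C
    _ ≤ |C| * R := by rw [mul_comm]; gcongr

end BratteliDiagram.Connectors

section Asymptotics

open Real

theorem exists_lt_lt_div_add_lt {b c α : ℝ} (hb : 0 ≤ b) (hc : 0 < c) (hα : b / (b + c) < α) :
    ∃ l τ, b < l ∧ 0 < τ ∧ τ < c ∧ l / (l + τ) < α := by
  have hbc : 0 < b + c := by positivity
  obtain ⟨l, hbl, hl⟩ : ∃ l, b < l ∧ l < min (b + c) (α * (b + c)) :=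
    exists_between (lt_min (by linarith) ((div_lt_iff₀ hbc).1 hα))
  obtain ⟨hlc, hlα⟩ := lt_min_iff.1 hl
  refine ⟨l, b + c - l, hbl, by linarith, by linarith, ?_⟩
  rwa [add_sub_cancel, div_lt_iff₀ hbc]

/-- The two bounds are balanced at `n = log R / (l + τ)`. -/
theorem exists_exp_mul_le_and_div_exp_pow_le {l τ : ℝ} (hl : 0 ≤ l) (hτ : 0 < τ) (N : ℕ) {R : ℝ}
    (hR : 1 ≤ R) :
    ∃ n ≥ N, exp (l * n) ≤ exp (l * (N + 1)) * R ^ (l / (l + τ)) ∧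
      R / exp τ ^ n ≤ R ^ (l / (l + τ)) := by
  have hlτ : 0 < l + τ := by positivity
  obtain ⟨x, hx, rfl⟩ : ∃ x ≥ 0, exp ((l + τ) * x) = R :=
    ⟨log R / (l + τ), div_nonneg (log_nonneg hR) hlτ.le,
      by rw [mul_div_cancel₀ _ hlτ.ne', exp_log (by positivity)]⟩
  have hpow : exp ((l + τ) * x) ^ (l / (l + τ)) = exp (l * x) := by
    rw [← exp_mul]
    congr 1
    field_simp
  have hxn : x ≤ ⌈x⌉₊ := Nat.le_ceil x
  have hnx : (⌈x⌉₊ : ℝ) < x + 1 := Nat.ceil_lt_add_one hx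
  refine ⟨⌈x⌉₊ + N, Nat.le_add_left _ _, ?_, ?_⟩
  · rw [hpow, ← exp_add, exp_le_exp, ← mul_add]
    refine mul_le_mul_of_nonneg_left ?_ hl
    push_cast
    linarith
  · rw [hpow, ← exp_nat_mul, ← exp_sub, exp_le_exp]
    push_cast
    nlinarith [(Nat.cast_nonneg N : (0 : ℝ) ≤ N)]

theorem pow_le_exp_rpow {a T u k : ℕ} {Y η : ℝ} (hη : 0 < η) (hY : a + T + 1 ≤ Y) :
    (((a * (u * a) * (a + T + 1)) ^ (k * (a + T)) : ℕ) : ℝ) ≤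
      exp (k * (u + 3 / η) * Y ^ (1 + η)) := by
  have haY : (a : ℝ) ≤ Y := by linarith [T.cast_nonneg (α := ℝ)]
  have hY1 : 1 ≤ Y := by linarith [T.cast_nonneg (α := ℝ), a.cast_nonneg (α := ℝ)]
  have hY0 : 0 < Y := by linarith
  have hbase : ((a * (u * a) * (a + T + 1) : ℕ) : ℝ) ≤ exp (u + 3 * log Y) := by
    have hu : (u : ℝ) ≤ exp u := by linarith [add_one_le_exp (u : ℝ)]
    push_cast
    calc (a : ℝ) * (u * a) * (a + T + 1) ≤ Y * (exp u * Y) * Y := by gcongr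
      _ = exp u * Y ^ 3 := by ring
      _ = exp (u + 3 * log Y) := by rw [exp_add, ← exp_log (pow_pos hY0 3), log_pow, Nat.cast_ofNat]
  have hlog : log Y ≤ Y ^ η / η := log_le_rpow_div hY0.le hη
  have hYη : 1 ≤ Y ^ η := one_le_rpow hY1 hη.le
  have hlog0 : 0 ≤ log Y := log_nonneg hY1
  have hexponent : ((k * (a + T) : ℕ) : ℝ) * (u + 3 * log Y) ≤ k * (u + 3 / η) * Y ^ (1 + η) :=
    calc ((k * (a + T) : ℕ) : ℝ) * (u + 3 * log Y)
        ≤ k * Y * (u * Y ^ η + 3 * (Y ^ η / η)) := by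
          push_cast
          gcongr
          · linarith
          · exact le_mul_of_one_le_right u.cast_nonneg hYη
      _ = k * (u + 3 / η) * Y ^ (1 + η) := by rw [rpow_add hY0, rpow_one]; ring
  calc (((a * (u * a) * (a + T + 1)) ^ (k * (a + T)) : ℕ) : ℝ)
      ≤ exp (u + 3 * log Y) ^ (k * (a + T)) := by
        rw [Nat.cast_pow]
        gcongr
    _ ≤ exp (k * (u + 3 / η) * Y ^ (1 + η)) := by
        rwa [← exp_nat_mul, exp_le_exp]

theorem growthDominated_exp_rpow {f : ℝ → ℝ} {K α : ℝ} (hα : 0 < α)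
    (h : ∀ R, 1 ≤ R → f R ≤ exp (K * R ^ α)) : GrowthDominated f fun R => exp (R ^ α) := by
  refine ⟨max 1 (|K| ^ α⁻¹), le_max_left _ _, fun R hR => (h R hR).trans (exp_le_exp.2 ?_)⟩
  have hK : K ≤ max 1 (|K| ^ α⁻¹) ^ α :=
    calc K ≤ |K| := le_abs_self K
      _ = (|K| ^ α⁻¹) ^ α := (rpow_inv_rpow (abs_nonneg K) hα.ne').symm
      _ ≤ max 1 (|K| ^ α⁻¹) ^ α := by gcongr; exact le_max_right _ _
  rw [mul_rpow (by positivity) (by positivity)]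
  gcongr

end Asymptotics

namespace BratteliDiagram.Connectors.PerfectAction

open Real

variable {V E S : Type*} {B : BratteliDiagram V E} {P : B.Connectors S} [InvolutiveInv S]
  {A : PerfectAction P}

theorem growthDominated_of_exists_level [Fintype V] [Nonempty V] [Finite E]
    (hP : P.IsTileInflation) {U : Set (List S)} (hU : U.Finite) {m : ℕ} {C δ α : ℝ} (hδ : 0 < δ)
    (hδα : δ < α)
    (h : ∀ R : ℝ, 1 ≤ R → ∃ n T : ℕ, A.IsGermSystem U m n ∧
      (∀ w : List S, w.length ≤ R → P.traverseCount w n ≤ T) ∧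
      Nat.card (B.FinPath n) + T + 1 ≤ C * R ^ δ) :
    GrowthDominated A.growth fun R => exp (R ^ α) := by
  obtain ⟨η, hη, hδη⟩ : ∃ η > 0, δ * (1 + η) = α :=
    ⟨α / δ - 1, sub_pos.2 ((one_lt_div hδ).2 hδα), by field_simp; ring⟩
  let k := Nat.card (B.FinPath m)
  refine growthDominated_exp_rpow (K := k * (U.ncard + 3 / η) * C ^ (1 + η)) (hδ.trans hδα)
    fun R hR => ?_
  obtain ⟨n, T, hgerm, hT, hY⟩ := h R hR
  have hRδ : 0 < R ^ δ := rpow_pos_of_pos (by linarith) δ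
  have hC : 0 ≤ C := (pos_of_mul_pos_left (lt_of_lt_of_le (by positivity) hY) hRδ.le).le
  calc A.growth R ≤ exp (k * (U.ncard + 3 / η) * (C * R ^ δ) ^ (1 + η)) :=
        (growth_le hP hU hgerm hT).trans (pow_le_exp_rpow hη hY)
    _ = exp (k * (U.ncard + 3 / η) * C ^ (1 + η) * R ^ α) := by
        rw [mul_rpow hC hRδ.le, ← rpow_mul (by linarith), hδη, ← mul_assoc]

end BratteliDiagram.Connectors.PerfectAction

open BratteliDiagram.Connectors in
theorem mainTheorem2_general {V E S : Type*} [Fintype V] [Finite E] [Finite S] [InvolutiveInv S]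
    (B : BratteliDiagram V E) (P : B.Connectors S) (hP : P.IsTileInflation)
    {N : ℕ} (hst : P.BoundaryStationaryFrom N) (A : PerfectAction P) (hcontr : A.IsContracting)
    (t₀ : ℝ) (ht₀ : 1 < t₀) (Ψ : ℝ → ℝ)
    (hΨ : ∀ (w : List S) (t : ℝ), 0 ≤ t → t < t₀ →
      Summable (fun n : ℕ => (P.traverseCount w n : ℝ) * t ^ n) ∧
      ∑' n : ℕ, (P.traverseCount w n : ℝ) * t ^ n ≤ w.length * Ψ t)
    (α : ℝ)
    (hα : Real.log (tileGrowthRate B) / (Real.log (tileGrowthRate B) + Real.log t₀) < α) :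
    GrowthDominated A.growth (fun R => Real.exp (R ^ α)) := by
  rcases isEmpty_or_nonempty V with hV | hV
  · exact ⟨1, le_rfl, fun R hR => (A.growth_le_one_of_isEmpty R).trans
      (Real.one_le_exp (by positivity))⟩
  obtain ⟨l, τ, hl, hτ, hτt₀, hδα⟩ :=
    exists_lt_lt_div_add_lt (Real.log_nonneg one_le_tileGrowthRate) (Real.log_pos ht₀) hα
  have hl0 : 0 < l := (Real.log_nonneg one_le_tileGrowthRate).trans_lt hl
  obtain ⟨U, m, hU, hgerm⟩ := A.exists_isGermSystem hP hst hcontr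
  obtain ⟨M, hM⟩ :=
    Filter.eventually_atTop.1 (hgerm.and (eventually_card_finPath_le hl))
  let c := |Ψ (Real.exp τ)|
  refine PerfectAction.growthDominated_of_exists_level (m := m) (δ := l / (l + τ))
    (C := Real.exp (l * (M + 1)) + c + 1) hP hU (by positivity) hδα fun R hR => ?_
  obtain ⟨n, hn, hcard, htrav⟩ := exists_exp_mul_le_and_div_exp_pow_le hl0.le hτ M hR
  refine ⟨n, ⌊c * R ^ (l / (l + τ))⌋₊, (hM n hn).1, fun w hw => Nat.le_floor ?_, ?_⟩
  · obtain ⟨hsum, hle⟩ :=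
      hΨ w (Real.exp τ) (Real.exp_pos τ).le ((Real.lt_log_iff_exp_lt (by positivity)).1 hτt₀)
    exact (traverseCount_le_of_tsum_le (Real.exp_pos τ) hsum hle hw n).trans (by gcongr)
  · have hRδ : 1 ≤ R ^ (l / (l + τ)) := Real.one_le_rpow hR (by positivity)
    linarith [(hM n hn).2, Nat.floor_le (a := c * R ^ (l / (l + τ))) (by positivity)]

theorem mainTheorem2 {V E S : Type*} [Fintype V] [Finite E] [Finite S] [InvolutiveInv S]
    (B : BratteliDiagram V E) (hB : B.IsSimple)
    (P : B.Connectors S) (hP : P.IsTileInflation) (hbd : P.IsBoundedType) (hst : P.IsStationary)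
    (A : BratteliDiagram.Connectors.PerfectAction P) (hmin : A.IsMinimal)
    (hcontr : A.IsContracting)
    (t₀ : ℝ) (ht₀ : 1 < t₀) (Ψ : ℝ → ℝ)
    (hΨ : ∀ (w : List S) (t : ℝ), 0 ≤ t → t < t₀ →
      Summable (fun n : ℕ => (P.traverseCount w n : ℝ) * t ^ n) ∧
      ∑' n : ℕ, (P.traverseCount w n : ℝ) * t ^ n ≤ w.length * Ψ t)
    (α : ℝ)
    (hα : Real.log (BratteliDiagram.Connectors.tileGrowthRate B) /
      (Real.log (BratteliDiagram.Connectors.tileGrowthRate B) + Real.log t₀) < α) :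
    GrowthDominated A.growth (fun R => Real.exp (R ^ α)) := by
  obtain ⟨N, hN⟩ := hst
  exact mainTheorem2_general B P hP (fun n hn => (hN n hn).1) A hcontr t₀ ht₀ Ψ hΨ α hα
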